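/- **Setting.** Let $d\ge 0$, and let $A=(a_1,\dots,a_n)$ be points of $\mathbb{R}^d$, possibly repeated or affinely dependent, whose affine span is $\mathbb{R}^d$. Put $v_i=(a_i,1)\in\mathbb{R}^{d+1}$, $V=(v_1,\dots,v_n)$ and $Z(V)=\sum_{i=1}^n[0,v_i]$. For $B\subseteq[n]$ with $|B|=d+1$ and $(a_b)_{b\in B}$ affinely independent, let $\det(B)>0$ be the absolute value of the determinant with rows $(a_b,1)$, $b\in B$. For $b\in B$ let $\lambda_{B,b}(x)$ be the $b$-th barycentric coordinate of $x$, i.e. the quotient of the determinant with row $(a_b,1)$ replaced by $(x,1)$ and the determinant with rows $(a_b,1)$ (same order of rows). For such $B$ and $I\subseteq[n]\setminus B$ let $\Pi_{I,B}=\sum_{i\in I}v_i+\sum_{b\in B}[0,v_b]$. Its faces are the sets $\Pi_{J,C}$ with $C\subseteq B$ and $I\subseteq J\subseteq I\cup(B\setminus C)$. A *fine zonotopal tiling* of $Z(V)$ is a finite collection $\mathcal P$ of labelled tiles $\Pi_{I,B}$ whose union is $Z(V)$ and such that the intersection of any two of them is empty or a common face $\Pi_{J,C}$ of both, with the same label $(J,C)$.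 For $X\subseteq[n]$ with $|X|=k+d+1$, the *simplex spline* $M(\cdot\,|X)$ is defined recursively. It is $0$ if the points $(a_i)_{i\in X}$ do not affinely span $\mathbb{R}^d$. Otherwise $$M(x|X)=\frac{d!}{\det(X)}\mathbf 1_X(x)\ \ (k=0),\qquad M(x|X)=\frac{k+d}{k}\sum_{b\in B}\lambda_{B,b}(x)\,M(x|X\setminus\{b\})\ \ (k\ge1),$$ where $B=B(X)\subseteq X$ is any chosen set of $d+1$ indices of affinely independent points, and $\mathbf 1_X$ is the indicator function of $\mathrm{ch}(\{a_i\}_{i\in X})$. **Theorem.** Let $\mathcal P$ be a fine zonotopal tiling of $Z(V)$, let $0\le k\le n-d-1$, let $\mathcal P^{(k)}=\{\Pi_{I,B}\in\mathcal P:|I|=k\}$ and $$\mathrm{ch}_k(A)=\bigcap_{S\subseteq[n],\,|S|=n-k}\mathrm{ch}(\{a_i\}_{i\in S}).$$ Let $q$ be a real polynomial of degree at most $k$ on $\mathbb{R}^d$, and let $Q$ be its polar form, i.e. the function of $k$ arguments in $\mathbb{R}^d$ which is symmetric, affine in each argument and satisfies $Q(x,\dots,x)=q(x)$ (it exists). Consider,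 for any choice of the sets $B(X)$ in the recursion, the identity $$q(x)=\frac{k!}{(k+d)!}\sum_{\Pi_{I,B}\in\mathcal P^{(k)}}Q((a_i)_{i\in I})\,\mathrm{vol}^{d+1}(\Pi_{I,B})\,M(x\,|\,I\cup B).\qquad(*)$$ 1. $(*)$ holds for every $x\in\mathrm{ch}_k(A)$ that lies in none of the sets $\mathrm{ch}(\{a_i\}_{i\in S})$, $S\subseteq[n]$, $|S|=d$; in particular it holds for almost every $x\in\mathrm{ch}_k(A)$. 2. $(*)$ holds for every $x\in\mathrm{ch}_k(A)$ without exception, if the values of the splines on this exceptional null set are fixed as follows: for an arbitrary fixed point $p\in\mathrm{ch}(A)$ that lies on none of the affine spans $\mathrm{aff}(\{a_i\}_{i\in S})$, $|S|=d$, the value $\mathbf 1_X(x)$ in the recursion is $1$ if $x+t(p-x)\in\mathrm{ch}(\{a_i\}_{i\in X})$ for all sufficiently small $t>0$, and $0$ otherwise. -/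

import Mathlib

open MeasureTheory Topology

noncomputable section

namespace ZonotopalSpline

/-- The projective lift `(x, 1) ∈ ℝ^(d+1)` of a point `x ∈ ℝ^d`. -/
def lift {d : ℕ} (x : Fin d → ℝ) : Fin (d + 1) → ℝ :=
  Fin.snoc x 1

/-- `B` indexes `d + 1` affinely independent points of the configuration `a`. -/
def IsBasis {d n : ℕ} (a : Fin n → Fin d → ℝ) (B : Finset (Fin n)) : Prop :=
  B.card = d + 1 ∧ AffineIndependent ℝ (fun i : B => a i)

/-- The determinant of the `(d+1) × (d+1)` matrix with rows `(a_i, 1)`, `i ∈ B`, taken in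
increasing order of the index (and `0` if `B` does not have `d + 1` elements). -/
def orderedDet {d n : ℕ} (a : Fin n → Fin d → ℝ) (B : Finset (Fin n)) : ℝ :=
  if h : B.card = d + 1 then
    Matrix.det (Matrix.of fun i : Fin (d + 1) => lift (a (B.orderEmbOfFin h i)))
  else 0

/-- The determinant `det(B) > 0`, with the rows ordered so that it is positive. -/
def posDet {d n : ℕ} (a : Fin n → Fin d → ℝ) (B : Finset (Fin n)) : ℝ :=
  |orderedDet a B|

/-- The quotient `det(B; b → x) / det(B)`: in the numerator the row `(a_b, 1)` is replaced by
`(x, 1)`. The quotient does not depend on the order of the rows. -/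
def detQuot {d n : ℕ} (a : Fin n → Fin d → ℝ) (B : Finset (Fin n)) (b : Fin n)
    (x : Fin d → ℝ) : ℝ :=
  orderedDet (Function.update a b x) B / orderedDet a B

/-- The convex hull of the points indexed by `S`. -/
def hull {d n : ℕ} (a : Fin n → Fin d → ℝ) (S : Finset (Fin n)) : Set (Fin d → ℝ) :=
  convexHull ℝ (a '' (S : Set (Fin n)))

/-- `ch_k(A)`: the intersection of the convex hulls of all subconfigurations of size `n - k`. -/
def chk {d n : ℕ} (a : Fin n → Fin d → ℝ) (k : ℕ) : Set (Fin d → ℝ) :=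
  {x | ∀ S : Finset (Fin n), S.card + k = n → x ∈ hull a S}

/-- The zonotope `Z(V) = ∑ [0, v_i]`, where `v_i = (a_i, 1)`. -/
def zonotope {d n : ℕ} (a : Fin n → Fin d → ℝ) : Set (Fin (d + 1) → ℝ) :=
  {z | ∃ α : Fin n → ℝ, (∀ i, α i ∈ Set.Icc (0 : ℝ) 1) ∧ z = ∑ i, α i • lift (a i)}

/-- The parallelepiped `Π_{I,B} = ∑_{i ∈ I} v_i + ∑_{b ∈ B} [0, v_b]`, where `T = (I, B)`. -/
def tile {d n : ℕ} (a : Fin n → Fin d → ℝ) (T : Finset (Fin n) × Finset (Fin n)) :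
    Set (Fin (d + 1) → ℝ) :=
  {z | ∃ α : Fin n → ℝ, (∀ i, α i ∈ Set.Icc (0 : ℝ) 1) ∧
    z = ∑ i ∈ T.1, lift (a i) + ∑ b ∈ T.2, α b • lift (a b)}

/-- `Π_{J,C}` is a face of `Π_{I,B}` (`F = (J, C)`, `T = (I, B)`): it is obtained by setting the
coefficients of the segments `[0, v_b]`, `b ∈ B \ C`, equal to `1` (for `b ∈ J`) or `0`. -/
def IsFace {n : ℕ} (F T : Finset (Fin n) × Finset (Fin n)) : Prop :=
  F.2 ⊆ T.2 ∧ T.1 ⊆ F.1 ∧ F.1 ⊆ T.1 ∪ (T.2 \ F.2)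

/-- `P` is (the set of labels `(I, B)` of the tiles of) a fine zonotopal tiling of `Z(V)`: the
tiles cover `Z(V)`, and any two tiles meet in a common face, possibly empty. -/
structure IsFineZonotopalTiling {d n : ℕ} (a : Fin n → Fin d → ℝ)
    (P : Finset (Finset (Fin n) × Finset (Fin n))) : Prop where
  disjoint : ∀ T ∈ P, Disjoint T.1 T.2
  basis : ∀ T ∈ P, IsBasis a T.2
  cover : (⋃ T ∈ P, tile a T) = zonotope a
  inter : ∀ T ∈ P, ∀ T' ∈ P, tile a T ∩ tile a T' = ∅ ∨
    ∃ F, IsFace F T ∧ IsFace F T' ∧ tile a T ∩ tile a T' = tile a F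

/-- A rule choosing, for each `X` whose points have full affine rank, the set `B ⊆ X` of `d + 1`
affinely independent points which is used in the spline recursion. -/
def IsSelection {d n : ℕ} (a : Fin n → Fin d → ℝ) (sel : Finset (Fin n) → Finset (Fin n)) :
    Prop :=
  ∀ X : Finset (Fin n), (∃ B ⊆ X, IsBasis a B) → sel X ⊆ X ∧ IsBasis a (sel X)

open Classical in
/-- The normalized simplex spline `M(x | (a_i)_{i ∈ X})` of degree `k`, where `X` has `k + d + 1`
elements, computed by the recursion with the choices `sel`; it is zero if the points indexed by `X`
do not have full affine rank. The function `χ B` is the indicator function of the simplex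
with vertices indexed by `B`. -/
def spline {d n : ℕ} (a : Fin n → Fin d → ℝ) (χ : Finset (Fin n) → (Fin d → ℝ) → ℝ)
    (sel : Finset (Fin n) → Finset (Fin n)) : ℕ → Finset (Fin n) → (Fin d → ℝ) → ℝ
  | 0, X, x =>
    if IsBasis a X then (d.factorial : ℝ) / posDet a X * χ X x else 0
  | k + 1, X, x =>
    if ∃ B ⊆ X, IsBasis a B then
      ((k + 1 + d : ℕ) : ℝ) / ((k + 1 : ℕ) : ℝ) *
        ∑ b ∈ sel X, detQuot a (sel X) b x * spline a χ sel k (X.erase b) x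
    else 0

/-- The indicator function of the closed convex hull of the points indexed by `X`. -/
def closedInd {d n : ℕ} (a : Fin n → Fin d → ℝ) (X : Finset (Fin n)) : (Fin d → ℝ) → ℝ :=
  Set.indicator (hull a X) 1

/-- The indicator function of the half-open convex hull of the points indexed by `X`, as seen from
`p`: its value at `x` is the limit of the closed indicator function along the segment from `x`
towards `p`. -/
def halfOpenInd {d n : ℕ} (a : Fin n → Fin d → ℝ) (p : Fin d → ℝ) (X : Finset (Fin n)) :
    (Fin d → ℝ) → ℝ :=
  Set.indicator {x | ∀ᶠ t in 𝓝[>] (0 : ℝ), x + t • (p - x) ∈ hull a X} 1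

/-- `Q` is the polar form of `q`, as a polynomial of degree at most `k`: it is symmetric, affine in
each of its `k` arguments, and agrees with `q` on the diagonal. -/
structure IsPolarForm {d : ℕ} (k : ℕ) (q : MvPolynomial (Fin d) ℝ)
    (Q : (Fin k → Fin d → ℝ) → ℝ) : Prop where
  symm : ∀ (π : Equiv.Perm (Fin k)) (y : Fin k → Fin d → ℝ), Q (y ∘ π) = Q y
  affine : ∀ (y : Fin k → Fin d → ℝ) (j : Fin k),
    ∃ f : (Fin d → ℝ) →ᵃ[ℝ] ℝ, ∀ z, Q (Function.update y j z) = f z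
  diag : ∀ x : Fin d → ℝ, Q (fun _ => x) = MvPolynomial.eval x q

/-- The value `Q((a_i)_{i ∈ I})`, where `I` has `k` elements. -/
def polarAt {d n k : ℕ} (a : Fin n → Fin d → ℝ) (Q : (Fin k → Fin d → ℝ) → ℝ)
    (I : Finset (Fin n)) : ℝ :=
  if h : I.card = k then Q (fun j => a (I.orderEmbOfFin h j)) else 0

/-- The sum
`k! / (k+d)! ∑_{(I,B) ∈ P, |I| = k} Q((a_i)_{i ∈ I}) vol(Π_{I,B}) M(x | (a_i)_{i ∈ I ∪ B})`. -/
def splineSum {d n : ℕ} (a : Fin n → Fin d → ℝ) (χ : Finset (Fin n) → (Fin d → ℝ) → ℝ)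
    (sel : Finset (Fin n) → Finset (Fin n)) (P : Finset (Finset (Fin n) × Finset (Fin n))) (k : ℕ)
    (Q : (Fin k → Fin d → ℝ) → ℝ) (x : Fin d → ℝ) : ℝ :=
  (k.factorial : ℝ) / ((k + d).factorial : ℝ) *
    ∑ T ∈ P with T.1.card = k,
      polarAt a Q T.1 * volume.real (tile a T) * spline a χ sel k (T.1 ∪ T.2) x

end ZonotopalSpline

end

/-!
The lift `z ↦ (z, 1)` turns affine dependences among the points into linear relations among the
`v_i`. Choose a point `y` which lies in no hull of `d` points and at which the closed indicator
functions take the values used by the splines at `x`: in the first part `y = x`, in the second `y`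
is a point of the segment from `x` to `p` close to `x`.

The splines at `x` respect linear relations, `∑ b ∈ X, μ b * M(x | X \ b) = 0` whenever
`∑ b ∈ X, μ b • v_b = 0`. In degree `0` this is a signed count of the simplices containing `y`,
and the recursion carries it to higher degrees. Hence `M(x | X)` can be expanded with any `ν` such
that `∑ b ∈ X, ν b • v_b = (x, 1)`, and not only with the chosen set `B(X)`.

Induct on `k`, expanding `M(x | I ∪ B)` along `B`. Each summand belongs to a pair of a tile and one
of its facets `Π_{J,C}`, and up to a sign recording the side on which the tile lies it depends on
the facet only. The two tiles at an interior facet therefore cancel, while a boundary facet with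
`|J| = k` does not contribute, since `x` is in the hull of the points outside `J`. So the sum over
the tiles with `|I| = k` becomes one over the tiles with `|I| = k - 1`, in which the symmetric
multiaffine `Q` has `x` as one of its arguments. For `k = 0` exactly one tile with `I = ∅` has `y`
in its simplex.
-/

noncomputable section

namespace ZonotopalSpline

section SignedSums

variable {ι 𝕜 : Type*} [Ring 𝕜] [LinearOrder 𝕜] [IsStrictOrderedRing 𝕜]

theorem sum_sign_eq_zero {f : ι → 𝕜} {K : Finset ι}
    (hinj : ∀ i ∈ K, ∀ j ∈ K, 0 < f i * f j → i = j)
    (hopp : ∀ i ∈ K, f i ≠ 0 → ∃ j ∈ K, f i * f j < 0) :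
    ∑ i ∈ K, (SignType.sign (f i) : 𝕜) = 0 := by
  by_cases hf : ∀ i ∈ K, f i = 0
  · exact Finset.sum_eq_zero fun i hi => by rw [hf i hi, sign_zero, SignType.coe_zero]
  push Not at hf
  obtain ⟨i, hi, hfi⟩ := hf
  obtain ⟨j, hj, hij⟩ := hopp i hi hfi
  have hne : i ≠ j := by
    rintro rfl
    exact (mul_self_nonneg _).not_gt hij
  have hrest : ∀ l ∈ K, l ≠ i ∧ l ≠ j → (SignType.sign (f l) : 𝕜) = 0 := by
    rintro l hl ⟨hli, hlj⟩
    have hi' : f l * f i ≤ 0 := not_lt.1 fun h => hli (hinj l hl i hi h)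
    have hj' : f l * f j ≤ 0 := not_lt.1 fun h => hlj (hinj l hl j hj h)
    have hl0 : f l = 0 := by
      rcases mul_neg_iff.1 hij with ⟨h₁, h₂⟩ | ⟨h₁, h₂⟩
      · exact le_antisymm (nonpos_of_mul_nonpos_left hi' h₁) (nonneg_of_mul_nonpos_left hj' h₂)
      · exact le_antisymm (nonpos_of_mul_nonpos_left hj' h₂) (nonneg_of_mul_nonpos_left hi' h₁)
    rw [hl0, sign_zero, SignType.coe_zero]
  rw [Finset.sum_eq_add_of_mem i j hi hj hne hrest]
  rcases mul_neg_iff.1 hij with ⟨h₁, h₂⟩ | ⟨h₁, h₂⟩ <;> simp [sign_pos, sign_neg, h₁, h₂]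

theorem sum_sum_eq_zero_of_antisymm {M : Type*} [AddCommGroup M] [IsAddTorsionFree M]
    {f : ι → ι → M} (hf : ∀ i j, f j i = -f i j) (X : Finset ι) :
    ∑ i ∈ X, ∑ j ∈ X, f i j = 0 := by
  refine self_eq_neg.1 ?_
  calc ∑ i ∈ X, ∑ j ∈ X, f i j = ∑ i ∈ X, ∑ j ∈ X, f j i := Finset.sum_comm
    _ = -∑ i ∈ X, ∑ j ∈ X, f i j := by simp_rw [← Finset.sum_neg_distrib, ← hf]

end SignedSums

section Relations

variable {𝕜 ι E : Type*} [Field 𝕜] [AddCommGroup E] [Module 𝕜 E] {v : ι → E}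

theorem relation_eq_div_mul_of_linearIndepOn [DecidableEq ι] {X : Finset ι} {c : ι}
    (hli : LinearIndepOn 𝕜 v (X.erase c : Finset ι)) {μ ν : ι → 𝕜}
    (hμ : ∑ i ∈ X, μ i • v i = 0) (hμc : μ c ≠ 0) (hν : ∑ i ∈ X, ν i • v i = 0) :
    ∀ i ∈ X, ν i = ν c / μ c * μ i := by
  have hsum : ∑ i ∈ X, (ν i - ν c / μ c * μ i) • v i = 0 := by
    simp only [sub_smul, mul_smul, Finset.sum_sub_distrib, ← Finset.smul_sum, hμ, hν, smul_zero,
      sub_zero]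
  have hc : ν c - ν c / μ c * μ c = 0 := by rw [div_mul_cancel₀ _ hμc, sub_self]
  rw [← Finset.sum_erase X (a := c) (by rw [hc, zero_smul])] at hsum
  intro i hi
  obtain rfl | hic := eq_or_ne i c
  · exact sub_eq_zero.1 hc
  · exact sub_eq_zero.1 (linearIndepOn_finset_iff.1 hli _ hsum i (Finset.mem_erase.2 ⟨hic, hi⟩))

section Ordered

variable [LinearOrder 𝕜] [IsStrictOrderedRing 𝕜] {X : Finset ι} {μ α β : ι → 𝕜}

theorem exists_nonneg_combination_pivot (hμ : ∑ i ∈ X, μ i • v i = 0)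
    (hα : ∀ i ∈ X, 0 ≤ α i) (hneg : ∃ c ∈ X, μ c < 0) :
    ∃ c ∈ X, μ c < 0 ∧ ∃ β : ι → 𝕜, (∀ i ∈ X, 0 ≤ β i) ∧ β c = 0 ∧
      ∑ i ∈ X, β i • v i = ∑ i ∈ X, α i • v i := by
  obtain ⟨c₀, hc₀, hμc₀⟩ := hneg
  obtain ⟨c, hc, hmin⟩ := {i ∈ X | μ i < 0}.exists_min_image (fun i => α i / -μ i)
    ⟨c₀, Finset.mem_filter.2 ⟨hc₀, hμc₀⟩⟩
  obtain ⟨hcX, hμc⟩ := Finset.mem_filter.1 hc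
  have ht : 0 ≤ α c / -μ c := div_nonneg (hα c hcX) (neg_nonneg.2 hμc.le)
  refine ⟨c, hcX, hμc, fun i => α i + α c / -μ c * μ i, fun i hi => ?_, ?_, ?_⟩
  · obtain h | h := lt_or_ge (μ i) 0
    · have hle := (le_div_iff₀ (neg_pos.2 h)).1 (hmin i (Finset.mem_filter.2 ⟨hi, h⟩))
      linarith
    · exact add_nonneg (hα i hi) (mul_nonneg ht h)
  · beta_reduce
    rw [div_neg, neg_mul, div_mul_cancel₀ _ hμc.ne, add_neg_cancel]
  · simp only [add_smul, mul_smul, Finset.sum_add_distrib, ← Finset.smul_sum, hμ, smul_zero,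
      add_zero]

theorem eq_zero_of_nonneg_combinations {b c : ι}
    (hμ : ∀ ν : ι → 𝕜, ∑ i ∈ X, ν i • v i = 0 → ∃ t, ∀ i ∈ X, ν i = t * μ i)
    (hb : b ∈ X) (hc : c ∈ X) (hbc : 0 < μ b * μ c) (hα : 0 ≤ α c) (hβ : 0 ≤ β b)
    (hαb : α b = 0) (hβc : β c = 0) (hαβ : ∑ i ∈ X, α i • v i = ∑ i ∈ X, β i • v i) :
    α c = 0 := by
  obtain ⟨t, ht⟩ := hμ (fun i => α i - β i) (by
    simp only [sub_smul, Finset.sum_sub_distrib, hαβ, sub_self])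
  have htb : -β b = t * μ b := by simpa only [hαb, zero_sub] using ht b hb
  have htc : α c = t * μ c := by simpa only [hβc, sub_zero] using ht c hc
  have hprod : t * t * (μ b * μ c) = -(α c * β b) := by
    linear_combination (-t * μ b) * htc - α c * htb
  have ht0 : t * t ≤ 0 :=
    nonpos_of_mul_nonpos_left (hprod.trans_le (neg_nonpos.2 (mul_nonneg hα hβ))) hbc
  rw [htc, mul_self_eq_zero.1 (ht0.antisymm (mul_self_nonneg t)), zero_mul]

end Ordered

/-- The values of the set function `F` at the deletions `X \ {b}` satisfy every linear relation
that holds among the vectors `v b`, `b ∈ X`. This is the identity between the splines of a given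
degree which makes the spline recursion independent of all choices. -/
def RespectsRelations [DecidableEq ι] (v : ι → E) (F : Finset ι → 𝕜) : Prop :=
  ∀ (X : Finset ι) (μ : ι → 𝕜), ∑ b ∈ X, μ b • v b = 0 → ∑ b ∈ X, μ b * F (X.erase b) = 0

namespace RespectsRelations

variable [DecidableEq ι] {F G : Finset ι → 𝕜} {X : Finset ι}

theorem sum_eq_sum (hF : RespectsRelations v F) {μ ν : ι → 𝕜}
    (h : ∑ b ∈ X, μ b • v b = ∑ b ∈ X, ν b • v b) :
    ∑ b ∈ X, μ b * F (X.erase b) = ∑ b ∈ X, ν b * F (X.erase b) := by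
  have hsub := hF X (fun b => μ b - ν b) (by
    simp only [sub_smul, Finset.sum_sub_distrib, h, sub_self])
  simpa only [sub_mul, Finset.sum_sub_distrib, sub_eq_zero] using hsub

variable {z : E} {r : 𝕜} {μ ν : ι → 𝕜}

theorem mul_apply_erase (hF : RespectsRelations v F)
    (hG : ∀ (X : Finset ι) (ν : ι → 𝕜), ∑ b ∈ X, ν b • v b = z →
      G X = r * ∑ b ∈ X, ν b * F (X.erase b))
    (hμ : ∑ b ∈ X, μ b • v b = 0) (hν : ∑ b ∈ X, ν b • v b = z) {b : ι} (hb : b ∈ X) :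
    μ b * G (X.erase b) =
      r * ∑ j ∈ X, (μ b * ν j - ν b * μ j) * F ((X.erase b).erase j) := by
  rw [← Finset.sum_erase X (a := b) (by ring)]
  have hμb : ∑ j ∈ X.erase b, μ j • v j = -(μ b • v b) := by
    rw [Finset.sum_erase_eq_sub hb, hμ, zero_sub]
  have hνb : ∑ j ∈ X.erase b, ν j • v j = z - ν b • v b := by
    rw [Finset.sum_erase_eq_sub hb, hν]
  obtain h0 | h0 := eq_or_ne (μ b) 0
  · have hrel := hF (X.erase b) μ (by rw [hμb, h0, zero_smul, neg_zero])
    simp only [h0, zero_mul, zero_sub, neg_mul, mul_assoc, Finset.sum_neg_distrib,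
      ← Finset.mul_sum, hrel, mul_zero, neg_zero]
  · rw [hG (X.erase b) (fun j => ν j - ν b / μ b * μ j)]
    · rw [mul_left_comm, Finset.mul_sum]
      refine congrArg (r * ·) (Finset.sum_congr rfl fun j _ => ?_)
      field_simp
    · simp only [sub_smul, mul_smul, Finset.sum_sub_distrib, ← Finset.smul_sum]
      rw [hνb, hμb, smul_neg, smul_smul, div_mul_cancel₀ _ h0, sub_neg_eq_add, sub_add_cancel]

theorem sum_mul_apply_erase_eq_zero [CharZero 𝕜] (hF : RespectsRelations v F)
    (hG : ∀ (X : Finset ι) (ν : ι → 𝕜), ∑ b ∈ X, ν b • v b = z →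
      G X = r * ∑ b ∈ X, ν b * F (X.erase b))
    (hμ : ∑ b ∈ X, μ b • v b = 0) (hν : ∑ b ∈ X, ν b • v b = z) :
    ∑ b ∈ X, μ b * G (X.erase b) = 0 := by
  rw [Finset.sum_congr rfl fun b hb => hF.mul_apply_erase hG hμ hν hb, ← Finset.mul_sum,
    sum_sum_eq_zero_of_antisymm, mul_zero]
  intro b j
  rw [Finset.erase_right_comm]
  ring

end RespectsRelations

end Relations

section OrderEmb

variable {ι : Type*} [LinearOrder ι]

theorem exists_perm_cons_orderEmbOfFin {s : Finset ι} {b : ι} (hb : b ∉ s) {m : ℕ}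
    (hs : s.card = m) (hbs : (insert b s).card = m + 1) :
    ∃ σ : Equiv.Perm (Fin (m + 1)),
      (Fin.cons b (s.orderEmbOfFin hs) : Fin (m + 1) → ι) = (insert b s).orderEmbOfFin hbs ∘ σ := by
  let e := ((insert b s).orderIsoOfFin hbs).toEquiv
  have hmem : ∀ i, (Fin.cons b (s.orderEmbOfFin hs) : Fin (m + 1) → ι) i ∈ insert b s :=
    Fin.cases (Finset.mem_insert_self b s)
      fun j => Finset.mem_insert_of_mem (Finset.orderEmbOfFin_mem s hs j)
  have hinj : Function.Injective (Fin.cons b (s.orderEmbOfFin hs) : Fin (m + 1) → ι) := by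
    rw [Fin.cons_injective_iff, Finset.range_orderEmbOfFin]
    exact ⟨hb, (s.orderEmbOfFin hs).injective⟩
  have hσ : Function.Injective fun i => e.symm ⟨_, hmem i⟩ := fun i j hij =>
    hinj (congrArg Subtype.val (e.symm.injective hij))
  refine ⟨Equiv.ofBijective _ (Finite.injective_iff_bijective.1 hσ), funext fun i => ?_⟩
  exact (congrArg Subtype.val (e.apply_symm_apply ⟨_, hmem i⟩)).symm

end OrderEmb

section Rays

variable {E : Type*} [AddCommGroup E] [Module ℝ E] {s : Set E} {x w p : E}

theorem eventually_notMem_affineSubspace (L : AffineSubspace ℝ E) (hp : p ∉ L) (x : E) :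
    ∀ᶠ t in 𝓝[>] (0 : ℝ), x + t • (p - x) ∉ L := by
  by_cases h : ∃ t₀ > (0 : ℝ), x + t₀ • (p - x) ∈ L
  · obtain ⟨t₀, ht₀, hmem⟩ := h
    filter_upwards [Ioo_mem_nhdsGT ht₀] with t ht hmem'
    have hne : t₀ - t ≠ 0 := (sub_pos.2 ht.2).ne'
    have hline := AffineMap.lineMap_mem ((1 - t) / (t₀ - t)) hmem' hmem
    have hcoef : (1 - t) / (t₀ - t) * (t₀ - t) + t = 1 := by
      rw [div_mul_cancel₀ _ hne, sub_add_cancel]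
    refine hp ?_
    convert hline using 1
    rw [AffineMap.lineMap_apply, vsub_eq_sub, vadd_eq_add, add_sub_add_left_eq_sub, ← sub_smul,
      smul_smul, add_left_comm, ← add_smul, hcoef, one_smul, add_sub_cancel]
  · filter_upwards [self_mem_nhdsWithin] with t ht hmem
    exact h ⟨t, ht, hmem⟩

variable [TopologicalSpace E] [ContinuousAdd E] [ContinuousSMul ℝ E]

theorem tendsto_add_smul_nhdsGT (x w : E) :
    Filter.Tendsto (fun t : ℝ => x + t • w) (𝓝[>] 0) (𝓝 x) := by
  have hcont : Continuous fun t : ℝ => x + t • w := by fun_prop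
  simpa only [zero_smul, add_zero] using (hcont.tendsto 0).mono_left nhdsWithin_le_nhds

theorem eventually_add_smul_mem_of_frequently (hs : Convex ℝ s) (hcl : IsClosed s)
    (h : ∃ᶠ t in 𝓝[>] (0 : ℝ), x + t • w ∈ s) : ∀ᶠ t in 𝓝[>] (0 : ℝ), x + t • w ∈ s := by
  have hx : x ∈ s := hcl.mem_of_frequently_of_tendsto h (tendsto_add_smul_nhdsGT x w)
  obtain ⟨t₀, hmem, ht₀⟩ := (h.and_eventually self_mem_nhdsWithin).exists
  filter_upwards [Ioo_mem_nhdsGT ht₀] with t ht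
  have hconv := hs.add_smul_mem hx hmem (t := t / t₀)
    ⟨(div_pos ht.1 ht₀).le, (div_le_one ht₀).2 ht.2.le⟩
  rwa [smul_smul, div_mul_cancel₀ _ (ne_of_gt ht₀)] at hconv

end Rays

variable {d n : ℕ} {a : Fin n → Fin d → ℝ}

section Hull

theorem sum_smul_lift {ι : Type*} (S : Finset ι) (w : ι → ℝ) (a : ι → Fin d → ℝ) :
    ∑ i ∈ S, w i • lift (a i) = Fin.snoc (∑ i ∈ S, w i • a i) (∑ i ∈ S, w i) := by
  funext j
  refine Fin.lastCases ?_ (fun j => ?_) j <;> simp [lift]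

theorem sum_smul_lift_eq_lift_iff {ι : Type*} {S : Finset ι} {w : ι → ℝ} {a : ι → Fin d → ℝ}
    {x : Fin d → ℝ} :
    ∑ i ∈ S, w i • lift (a i) = lift x ↔ ∑ i ∈ S, w i • a i = x ∧ ∑ i ∈ S, w i = 1 := by
  rw [sum_smul_lift, lift, Fin.snoc_inj]

theorem sum_smul_lift_eq_zero_iff {ι : Type*} {S : Finset ι} {w : ι → ℝ} {a : ι → Fin d → ℝ} :
    ∑ i ∈ S, w i • lift (a i) = 0 ↔ ∑ i ∈ S, w i • a i = 0 ∧ ∑ i ∈ S, w i = 0 := by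
  have hzero : (0 : Fin (d + 1) → ℝ) = Fin.snoc (α := fun _ => ℝ) 0 0 := by
    funext j
    refine Fin.lastCases ?_ (fun j => ?_) j <;> simp
  rw [sum_smul_lift, hzero, Fin.snoc_inj]

theorem lift_add_smul_of_add_eq_one {s t : ℝ} (hst : s + t = 1) (x y : Fin d → ℝ) :
    lift (s • x + t • y) = s • lift x + t • lift y := by
  funext j
  refine Fin.lastCases ?_ (fun j => ?_) j <;> simp [lift, hst]

theorem mem_hull_iff {S X : Finset (Fin n)} (hSX : S ⊆ X) {x : Fin d → ℝ} :
    x ∈ hull a S ↔ ∃ w : Fin n → ℝ, (∀ i ∈ X, 0 ≤ w i) ∧ (∀ i ∈ X, i ∉ S → w i = 0) ∧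
      ∑ i ∈ X, w i • lift (a i) = lift x := by
  constructor
  · refine fun h => convexHull_min (t := {x | ∃ w : Fin n → ℝ, (∀ i ∈ X, 0 ≤ w i) ∧
      (∀ i ∈ X, i ∉ S → w i = 0) ∧ ∑ i ∈ X, w i • lift (a i) = lift x}) ?_ ?_ h
    · rintro _ ⟨i, hi, rfl⟩
      refine ⟨Pi.single i 1, fun j _ => ?_, fun j _ hj => ?_, ?_⟩
      · exact (Pi.single_nonneg.2 zero_le_one : (0 : Fin n → ℝ) ≤ Pi.single i 1) j
      · exact Pi.single_eq_of_ne (ne_of_mem_of_not_mem hi hj).symm 1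
      · simp [Pi.single_apply, hSX hi]
    · rintro x ⟨w, hw, hwS, hwx⟩ y ⟨w', hw', hwS', hwy⟩ s t hs ht hst
      refine ⟨fun i => s * w i + t * w' i, fun i hi => ?_, fun i hi hiS => ?_, ?_⟩
      · exact add_nonneg (mul_nonneg hs (hw i hi)) (mul_nonneg ht (hw' i hi))
      · beta_reduce
        rw [hwS i hi hiS, hwS' i hi hiS, mul_zero, mul_zero, add_zero]
      · rw [lift_add_smul_of_add_eq_one hst, ← hwx, ← hwy]
        simp only [add_smul, mul_smul, Finset.sum_add_distrib, Finset.smul_sum]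
  · rintro ⟨w, hw, hwS, hwx⟩
    rw [← Finset.sum_subset hSX fun i hi hiS => by rw [hwS i hi hiS, zero_smul],
      sum_smul_lift_eq_lift_iff] at hwx
    rw [← hwx.1]
    exact (convex_convexHull ℝ _).sum_mem (fun i hi => hw i (hSX hi)) hwx.2
      fun i hi => subset_convexHull ℝ _ ⟨i, hi, rfl⟩

theorem mem_hull_erase_iff {X : Finset (Fin n)} {b : Fin n} (hb : b ∈ X) {x : Fin d → ℝ} :
    x ∈ hull a (X.erase b) ↔ ∃ w : Fin n → ℝ, (∀ i ∈ X, 0 ≤ w i) ∧ w b = 0 ∧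
      ∑ i ∈ X, w i • lift (a i) = lift x := by
  rw [mem_hull_iff (Finset.erase_subset b X)]
  refine exists_congr fun w => and_congr_right fun _ => and_congr_left fun _ => ⟨fun h => ?_, ?_⟩
  · exact h b hb (Finset.notMem_erase b X)
  · rintro h i hi hib
    obtain rfl : i = b := by simpa [hi] using hib
    exact h

theorem hull_mono {S S' : Finset (Fin n)} (h : S ⊆ S') : hull a S ⊆ hull a S' :=
  convexHull_mono (Set.image_mono (Finset.coe_subset.2 h))

theorem isClosed_hull (a : Fin n → Fin d → ℝ) (S : Finset (Fin n)) : IsClosed (hull a S) :=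
  (S.finite_toSet.image a).isClosed_convexHull ℝ

theorem map_lift_nonneg_of_mem_hull {S : Finset (Fin n)} {x : Fin d → ℝ} (hx : x ∈ hull a S)
    (f : (Fin (d + 1) → ℝ) →ₗ[ℝ] ℝ) (hf : ∀ i ∈ S, 0 ≤ f (lift (a i))) : 0 ≤ f (lift x) := by
  obtain ⟨w, hw, -, hwx⟩ := (mem_hull_iff subset_rfl).1 hx
  rw [← hwx, map_sum]
  simp only [map_smul, smul_eq_mul]
  exact Finset.sum_nonneg fun i hi => mul_nonneg (hw i hi) (hf i hi)

end Hull

section Determinants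

variable {B C S : Finset (Fin n)} {b c : Fin n}

theorem isBasis_iff_linearIndepOn :
    IsBasis a B ↔ B.card = d + 1 ∧ LinearIndepOn ℝ (fun i => lift (a i)) (B : Set (Fin n)) := by
  refine and_congr_right fun _ => ?_
  change _ ↔ LinearIndependent ℝ fun i : B => lift (a i)
  rw [affineIndependent_iff, linearIndependent_iff']
  refine forall_congr' fun s => forall_congr' fun w => ?_
  rw [sum_smul_lift_eq_zero_iff (a := fun i : B => a i), and_comm (a := _ = (0 : Fin d → ℝ)),
    and_imp]

theorem isBasis_iff_posDet_ne_zero : IsBasis a B ↔ posDet a B ≠ 0 := by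
  rw [isBasis_iff_linearIndepOn, posDet, abs_ne_zero, orderedDet]
  split_ifs with h
  · rw [← isUnit_iff_ne_zero, ← Matrix.isUnit_iff_isUnit_det,
      ← Matrix.linearIndependent_rows_iff_isUnit, LinearIndepOn,
      ← linearIndependent_equiv (B.orderIsoOfFin h).toEquiv]
    exact and_iff_right h
  · simp [h]

theorem IsBasis.posDet_pos (h : IsBasis a B) : 0 < posDet a B :=
  (abs_nonneg _).lt_of_ne' (isBasis_iff_posDet_ne_zero.1 h)

/-- The linear functional `z ↦ det(z, (v_c)_{c ∈ C})`, which vanishes on the hyperplane spanned by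
the lifted points indexed by `C`. The rows are in increasing order of the index, and the functional
is `0` if `C` does not have `d` elements. -/
def facetForm (a : Fin n → Fin d → ℝ) (C : Finset (Fin n)) : (Fin (d + 1) → ℝ) →ₗ[ℝ] ℝ :=
  if h : C.card = d then
    (Matrix.detRowAlternating (R := ℝ) (n := Fin (d + 1))).toMultilinearMap.toLinearMap
      (Fin.cons 0 fun j => lift (a (C.orderEmbOfFin h j))) 0
  else 0

theorem facetForm_apply (h : C.card = d) (z : Fin (d + 1) → ℝ) :
    facetForm a C z =
      Matrix.det (Matrix.of (Fin.cons z fun j => lift (a (C.orderEmbOfFin h j)))) := by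
  simp only [facetForm, dif_pos h]
  change Matrix.det (Function.update _ _ _) = _
  rw [Fin.update_cons_zero]
  rfl

theorem facetForm_lift_of_mem (hc : c ∈ C) : facetForm a C (lift (a c)) = 0 := by
  by_cases h : C.card = d
  · obtain ⟨j, hj⟩ : c ∈ Set.range (C.orderEmbOfFin h) := by
      rwa [Finset.range_orderEmbOfFin]
    rw [facetForm_apply h]
    refine Matrix.det_zero_of_row_eq (Fin.succ_ne_zero j).symm (funext fun i => ?_)
    simp [hj]
  · simp [facetForm, h]

theorem facetForm_congr {a' : Fin n → Fin d → ℝ} (h : ∀ c ∈ C, a c = a' c) :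
    facetForm a C = facetForm a' C := by
  by_cases hC : C.card = d
  · have hrows : ∀ j, a (C.orderEmbOfFin hC j) = a' (C.orderEmbOfFin hC j) :=
      fun j => h _ (C.orderEmbOfFin_mem hC j)
    simp only [facetForm, dif_pos hC, hrows]
  · simp only [facetForm, dif_neg hC]

theorem exists_orderedDet_insert (d : ℕ) (hb : b ∉ C) :
    ∃ ε : ℝ, |ε| = 1 ∧ ∀ a : Fin n → Fin d → ℝ,
      orderedDet a (insert b C) = ε * facetForm a C (lift (a b)) := by
  by_cases h : C.card = d
  · have h' : (insert b C).card = d + 1 := by rw [Finset.card_insert_of_notMem hb, h]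
    obtain ⟨σ, hσ⟩ := exists_perm_cons_orderEmbOfFin hb h h'
    refine ⟨(Equiv.Perm.sign σ : ℤ), by simp [← Int.cast_abs], fun a => ?_⟩
    have hrows : Matrix.of (Fin.cons (lift (a b)) fun j => lift (a (C.orderEmbOfFin h j))) =
        (Matrix.of fun i => lift (a ((insert b C).orderEmbOfFin h' i))).submatrix σ id := by
      ext i j
      simp only [Matrix.of_apply, Matrix.submatrix_apply, id, ← Function.comp_apply (g := σ),
        ← hσ]
      refine Fin.cases ?_ (fun i => ?_) i <;> simp
    rw [facetForm_apply h, hrows, Matrix.det_permute, orderedDet, dif_pos h', ← mul_assoc,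
      ← Int.cast_mul, Int.units_coe_mul_self, Int.cast_one, one_mul]
  · refine ⟨1, abs_one, fun a => ?_⟩
    have h' : (insert b C).card ≠ d + 1 := by
      rwa [Finset.card_insert_of_notMem hb, Ne, add_left_inj]
    simp [orderedDet, facetForm, h, h']

theorem posDet_insert (hb : b ∉ C) :
    posDet a (insert b C) = |facetForm a C (lift (a b))| := by
  obtain ⟨ε, hε, h⟩ := exists_orderedDet_insert d hb
  rw [posDet, h, abs_mul, hε, one_mul]

theorem posDet_eq_of_mem (hb : b ∈ B) :
    posDet a B = |facetForm a (B.erase b) (lift (a b))| := by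
  rw [← posDet_insert (Finset.notMem_erase b B), Finset.insert_erase hb]

theorem IsBasis.facetForm_ne_zero (h : IsBasis a B) (hb : b ∈ B) :
    facetForm a (B.erase b) (lift (a b)) ≠ 0 := by
  rw [← abs_pos, ← posDet_eq_of_mem hb]
  exact h.posDet_pos

/-- The `b`-th coordinate of a vector in the basis of lifted points indexed by `B`. -/
def coordForm (a : Fin n → Fin d → ℝ) (B : Finset (Fin n)) (b : Fin n) :
    (Fin (d + 1) → ℝ) →ₗ[ℝ] ℝ :=
  (facetForm a (B.erase b) (lift (a b)))⁻¹ • facetForm a (B.erase b)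

theorem coordForm_apply (a : Fin n → Fin d → ℝ) (B : Finset (Fin n)) (b : Fin n)
    (z : Fin (d + 1) → ℝ) :
    coordForm a B b z = facetForm a (B.erase b) z / facetForm a (B.erase b) (lift (a b)) :=
  (div_eq_inv_mul _ _).symm

theorem detQuot_eq_coordForm (hb : b ∈ B) (x : Fin d → ℝ) :
    detQuot a B b x = coordForm a B b (lift x) := by
  obtain ⟨ε, hε, h⟩ := exists_orderedDet_insert d (Finset.notMem_erase b B)
  have hε0 : ε ≠ 0 := abs_pos.1 (hε ▸ one_pos)
  rw [Finset.insert_erase hb] at h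
  have hcongr : facetForm (Function.update a b x) (B.erase b) = facetForm a (B.erase b) :=
    facetForm_congr fun c hc => Function.update_of_ne (Finset.ne_of_mem_erase hc) _ _
  rw [detQuot, h, h, mul_div_mul_left _ _ hε0, Function.update_self, hcongr, coordForm_apply]

theorem IsBasis.coordForm_sum (h : IsBasis a B) (hb : b ∈ B) (hS : S ⊆ B) (w : Fin n → ℝ) :
    coordForm a B b (∑ i ∈ S, w i • lift (a i)) = if b ∈ S then w b else 0 := by
  have hself : coordForm a B b (lift (a b)) = 1 := by
    rw [coordForm_apply, div_self (h.facetForm_ne_zero hb)]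
  have hne : ∀ i ∈ S, i ≠ b → coordForm a B b (lift (a i)) = 0 := fun i hi hib => by
    rw [coordForm_apply, facetForm_lift_of_mem (Finset.mem_erase.2 ⟨hib, hS hi⟩), zero_div]
  simp only [map_sum, map_smul, smul_eq_mul]
  rw [← Finset.sum_ite_eq' S b w]
  refine Finset.sum_congr rfl fun i hi => ?_
  split_ifs with hib
  · rw [hib, hself, mul_one]
  · rw [hne i hi hib, mul_zero]

theorem IsBasis.sum_coordForm (h : IsBasis a B) (z : Fin (d + 1) → ℝ) :
    ∑ b ∈ B, coordForm a B b z • lift (a b) = z := by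
  obtain ⟨hcard, hli⟩ := isBasis_iff_linearIndepOn.1 h
  have hspan : Submodule.span ℝ ((fun i => lift (a i)) '' (B : Set (Fin n))) = ⊤ := by
    rw [Set.image_eq_range]
    exact hli.span_eq_top_of_card_eq_finrank' (by simp [hcard])
  have hz : z ∈ Submodule.span ℝ ((fun i => lift (a i)) '' (B : Set (Fin n))) :=
    hspan.ge Submodule.mem_top
  obtain ⟨w, hw⟩ := (Submodule.mem_span_image_finset_iff_exists_fun' ℝ).1 hz
  conv_rhs => rw [← hw]
  refine Finset.sum_congr rfl fun b hb => ?_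
  rw [← hw, h.coordForm_sum hb subset_rfl, if_pos hb]

theorem IsBasis.sum_detQuot (h : IsBasis a B) (x : Fin d → ℝ) :
    ∑ b ∈ B, detQuot a B b x • lift (a b) = lift x :=
  (Finset.sum_congr rfl fun b hb => by rw [detQuot_eq_coordForm hb]).trans
    (h.sum_coordForm (lift x))

end Determinants

section Splines

variable {χ : Finset (Fin n) → (Fin d → ℝ) → ℝ} {sel : Finset (Fin n) → Finset (Fin n)}
  {x : Fin d → ℝ} {X : Finset (Fin n)}

theorem spline_eq_zero_of_no_basis (h : ¬ ∃ B ⊆ X, IsBasis a B) (k : ℕ) :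
    spline a χ sel k X x = 0 := by
  cases k with
  | zero => rw [spline, if_neg fun hX => h ⟨X, subset_rfl, hX⟩]
  | succ k => rw [spline, if_neg h]

theorem spline_erase_eq_zero_of_no_basis (h : ¬ ∃ B ⊆ X, IsBasis a B) (k : ℕ) (b : Fin n) :
    spline a χ sel k (X.erase b) x = 0 :=
  spline_eq_zero_of_no_basis
    (fun ⟨B, hB, hB'⟩ => h ⟨B, hB.trans (Finset.erase_subset b X), hB'⟩) k

theorem mem_hull_of_spline_ne_zero (hχ : ∀ B, χ B x ≠ 0 → x ∈ hull a B) {k : ℕ}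
    (h : spline a χ sel k X x ≠ 0) : x ∈ hull a X := by
  induction k generalizing X with
  | zero =>
    rw [spline] at h
    split_ifs at h
    · exact hχ X (right_ne_zero_of_mul h)
    · exact absurd rfl h
  | succ k ih =>
    rw [spline] at h
    split_ifs at h
    · obtain ⟨b, -, hb⟩ := Finset.exists_ne_zero_of_sum_ne_zero (right_ne_zero_of_mul h)
      exact hull_mono (Finset.erase_subset b X) (ih (right_ne_zero_of_mul hb))
    · exact absurd rfl h

theorem spline_succ (hsel : IsSelection a sel) {k : ℕ}
    (hR : RespectsRelations (fun i => lift (a i)) fun X => spline a χ sel k X x)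
    {ν : Fin n → ℝ} (hν : ∑ b ∈ X, ν b • lift (a b) = lift x) :
    spline a χ sel (k + 1) X x = ((k + 1 + d : ℕ) : ℝ) / ((k + 1 : ℕ) : ℝ) *
      ∑ b ∈ X, ν b * spline a χ sel k (X.erase b) x := by
  by_cases hX : ∃ B ⊆ X, IsBasis a B
  · obtain ⟨hs, hB⟩ := hsel X hX
    have hcoord : ∑ b ∈ X, (if b ∈ sel X then detQuot a (sel X) b x else 0) • lift (a b) =
        lift x := by
      simp only [ite_smul, zero_smul, Finset.sum_ite_mem, Finset.inter_eq_right.2 hs,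
        hB.sum_detQuot x]
    rw [spline, if_pos hX, ← hR.sum_eq_sum (hcoord.trans hν.symm)]
    simp only [ite_mul, zero_mul, Finset.sum_ite_mem, Finset.inter_eq_right.2 hs]
  · simp only [spline_eq_zero_of_no_basis hX, spline_erase_eq_zero_of_no_basis hX, mul_zero,
      Finset.sum_const_zero]

theorem respectsRelations_spline_succ (hsel : IsSelection a sel) {k : ℕ}
    (hR : RespectsRelations (fun i => lift (a i)) fun X => spline a χ sel k X x) :
    RespectsRelations (fun i => lift (a i)) fun X => spline a χ sel (k + 1) X x := by
  intro X μ hμ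
  by_cases hX : ∃ B ⊆ X, IsBasis a B
  · obtain ⟨B, hBX, hB⟩ := hX
    refine hR.sum_mul_apply_erase_eq_zero (G := fun X => spline a χ sel (k + 1) X x)
      (fun X ν hν => spline_succ hsel hR hν) hμ
      (ν := fun b => if b ∈ B then detQuot a B b x else 0) ?_
    simp only [ite_smul, zero_smul, Finset.sum_ite_mem, Finset.inter_eq_right.2 hBX,
      hB.sum_detQuot x]
  · simp only [spline_erase_eq_zero_of_no_basis hX, mul_zero, Finset.sum_const_zero]

theorem respectsRelations_spline (hsel : IsSelection a sel)
    (h : RespectsRelations (fun i => lift (a i)) fun X => spline a χ sel 0 X x) (k : ℕ) :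
    RespectsRelations (fun i => lift (a i)) fun X => spline a χ sel k X x := by
  induction k with
  | zero => exact h
  | succ k ih => exact respectsRelations_spline_succ hsel ih

end Splines

section GenericPoints

variable {X : Finset (Fin n)} {μ : Fin n → ℝ} {b c c₀ : Fin n} {x y p : Fin d → ℝ}

theorem abs_mul_posDet_erase (hμ : ∑ b ∈ X, μ b • lift (a b) = 0) (hb : b ∈ X) (hc : c ∈ X) :
    |μ c| * posDet a (X.erase b) = |μ b| * posDet a (X.erase c) := by
  obtain rfl | hbc := eq_or_ne b c
  · rfl
  have hcb : c ∈ X.erase b := Finset.mem_erase.2 ⟨hbc.symm, hc⟩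
  have hbc' : b ∈ X.erase c := Finset.mem_erase.2 ⟨hbc, hb⟩
  have hform : ∑ j ∈ X, μ j * facetForm a ((X.erase b).erase c) (lift (a j)) = 0 := by
    simpa using congrArg (facetForm a ((X.erase b).erase c)) hμ
  rw [← Finset.add_sum_erase X _ hb, ← Finset.add_sum_erase _ _ hcb, Finset.sum_eq_zero
    fun j hj => by rw [facetForm_lift_of_mem hj, mul_zero], add_zero] at hform
  rw [posDet_eq_of_mem hcb, posDet_eq_of_mem hbc', Finset.erase_right_comm (a := c), ← abs_mul,
    ← abs_mul, eq_neg_of_add_eq_zero_left hform, abs_neg]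

theorem exists_mem_hull_erase (hμ : ∑ b ∈ X, μ b • lift (a b) = 0) (hb : b ∈ X)
    (hμb : μ b ≠ 0) (hy : y ∈ hull a (X.erase b)) :
    ∃ c ∈ X, μ b * μ c < 0 ∧ y ∈ hull a (X.erase c) := by
  wlog hpos : 0 < μ b generalizing μ
  · obtain ⟨c, hc, hbc, hyc⟩ := this (μ := -μ) (by simp [hμ]) (neg_ne_zero.2 hμb)
      (neg_pos.2 (hμb.lt_of_le (not_lt.1 hpos)))
    exact ⟨c, hc, by simpa using hbc, hyc⟩
  obtain ⟨α, hα, -, hαy⟩ := (mem_hull_erase_iff hb).1 hy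
  have hneg : ∃ c ∈ X, μ c < 0 := by
    by_contra! h
    exact hpos.ne' ((Finset.sum_eq_zero_iff_of_nonneg h).1 (sum_smul_lift_eq_zero_iff.1 hμ).2 b hb)
  obtain ⟨c, hc, hμc, β, hβ, hβc, hβα⟩ := exists_nonneg_combination_pivot hμ hα hneg
  exact ⟨c, hc, mul_neg_of_pos_of_neg hpos hμc,
    (mem_hull_erase_iff hc).2 ⟨β, hβ, hβc, hβα.trans hαy⟩⟩

/-- The point `y` is not in the convex hull of any `d` points of the configuration. -/
def IsGeneric (a : Fin n → Fin d → ℝ) (y : Fin d → ℝ) : Prop :=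
  ∀ S : Finset (Fin n), S.card = d → y ∉ hull a S

theorem IsGeneric.eq_of_mem_hull_erase (hy : IsGeneric a y)
    (hμ : ∑ b ∈ X, μ b • lift (a b) = 0) (hc₀ : c₀ ∈ X) (hB : IsBasis a (X.erase c₀))
    (hμc₀ : μ c₀ ≠ 0) (hb : b ∈ X) (hc : c ∈ X) (hbc : 0 < μ b * μ c)
    (hyb : y ∈ hull a (X.erase b)) (hyc : y ∈ hull a (X.erase c)) : b = c := by
  by_contra hne
  obtain ⟨α, hα, hαb, hαy⟩ := (mem_hull_erase_iff hb).1 hyb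
  obtain ⟨β, hβ, hβc, hβy⟩ := (mem_hull_erase_iff hc).1 hyc
  have hli := (isBasis_iff_linearIndepOn.1 hB).2
  have hαc : α c = 0 := eq_zero_of_nonneg_combinations
    (fun ν hν => ⟨_, relation_eq_div_mul_of_linearIndepOn hli hμ hμc₀ hν⟩) hb hc hbc (hα c hc)
    (hβ b hb) hαb hβc (hαy.trans hβy.symm)
  have hcb : c ∈ X.erase b := Finset.mem_erase.2 ⟨Ne.symm hne, hc⟩
  have hcard : ((X.erase b).erase c).card = d := by
    have := hB.1
    grind
  refine hy _ hcard ((mem_hull_iff ?_).2 ⟨α, hα, fun i hi hi' => ?_, hαy⟩)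
  · exact (Finset.erase_subset _ _).trans (Finset.erase_subset _ _)
  · obtain rfl | rfl : i = b ∨ i = c := by grind
    · exact hαb
    · exact hαc

theorem IsGeneric.sum_sign_mul_closedInd (hy : IsGeneric a y)
    (hμ : ∑ b ∈ X, μ b • lift (a b) = 0) (hc : c ∈ X) (hB : IsBasis a (X.erase c))
    (hμc : μ c ≠ 0) :
    ∑ b ∈ X, (SignType.sign (μ b) : ℝ) * closedInd a (X.erase b) y = 0 := by
  classical
  have hsum : ∑ b ∈ X with y ∈ hull a (X.erase b), (SignType.sign (μ b) : ℝ) = 0 := by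
    refine sum_sign_eq_zero (fun b hb b' hb' hbb' => ?_) fun b hb hμb => ?_
    · obtain ⟨hb, hyb⟩ := Finset.mem_filter.1 hb
      obtain ⟨hb', hyb'⟩ := Finset.mem_filter.1 hb'
      exact hy.eq_of_mem_hull_erase hμ hc hB hμc hb hb' hbb' hyb hyb'
    · obtain ⟨hb, hyb⟩ := Finset.mem_filter.1 hb
      obtain ⟨b', hb', hneg, hyb'⟩ := exists_mem_hull_erase hμ hb hμb hyb
      exact ⟨b', Finset.mem_filter.2 ⟨hb', hyb'⟩, hneg⟩
  rw [Finset.sum_filter] at hsum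
  simpa only [closedInd, Set.indicator_apply, Pi.one_apply, mul_ite, mul_one, mul_zero] using hsum

variable {χ : Finset (Fin n) → (Fin d → ℝ) → ℝ}

theorem mul_spline_zero_erase (sel : Finset (Fin n) → Finset (Fin n))
    (hμ : ∑ b ∈ X, μ b • lift (a b) = 0) (hb : b ∈ X) (hc : c ∈ X)
    (hB : IsBasis a (X.erase c)) :
    μ b * spline a χ sel 0 (X.erase b) x =
      d.factorial * |μ c| / posDet a (X.erase c) *
        ((SignType.sign (μ b) : ℝ) * χ (X.erase b) x) := by
  obtain h0 | h0 := eq_or_ne (μ b) 0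
  · simp [h0]
  have hdet := abs_mul_posDet_erase hμ hb hc
  have hμb := abs_pos.2 h0
  have hc0 := hB.posDet_pos
  have hb0 : posDet a (X.erase b) ≠ 0 := fun h => (mul_pos hμb hc0).ne (by rw [← hdet, h, mul_zero])
  have hquot : (d.factorial : ℝ) / posDet a (X.erase b) * |μ b| =
      d.factorial * |μ c| / posDet a (X.erase c) := by
    field_simp
    linear_combination -hdet
  rw [spline, if_pos (isBasis_iff_posDet_ne_zero.2 hb0), ← hquot]
  conv_lhs => rw [← sign_mul_abs (μ b)]
  ring

/-- The point `y` is generic, and the closed indicator functions take at `y` the values which the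
indicator functions `χ` take at `x`: splines at `x` can be evaluated with the geometry of `y`. -/
structure IsGenericModel (a : Fin n → Fin d → ℝ) (χ : Finset (Fin n) → (Fin d → ℝ) → ℝ)
    (x y : Fin d → ℝ) : Prop where
  generic : IsGeneric a y
  apply_eq : ∀ B, χ B x = closedInd a B y
  mem_hull : ∀ B, y ∈ hull a B → x ∈ hull a B

theorem IsGenericModel.mem_hull_of_apply_ne_zero (hM : IsGenericModel a χ x y)
    {B : Finset (Fin n)} (h : χ B x ≠ 0) : x ∈ hull a B := by
  rw [hM.apply_eq] at h
  exact hM.mem_hull B (Set.mem_of_indicator_ne_zero h)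

theorem IsGenericModel.respectsRelations_spline_zero (hM : IsGenericModel a χ x y)
    (sel : Finset (Fin n) → Finset (Fin n)) :
    RespectsRelations (fun i => lift (a i)) fun X => spline a χ sel 0 X x := by
  intro X μ hμ
  by_cases hex : ∃ c ∈ X, IsBasis a (X.erase c) ∧ μ c ≠ 0
  · obtain ⟨c, hc, hB, hμc⟩ := hex
    rw [Finset.sum_congr rfl fun b hb => mul_spline_zero_erase sel hμ hb hc hB,
      ← Finset.mul_sum]
    simp only [hM.apply_eq, hM.generic.sum_sign_mul_closedInd hμ hc hB hμc, mul_zero]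
  · push Not at hex
    refine Finset.sum_eq_zero fun b hb => ?_
    by_cases hB : IsBasis a (X.erase b)
    · rw [hex b hb hB, zero_mul]
    · simp only [spline, if_neg hB, mul_zero]

theorem isGenericModel_closedInd (hx : IsGeneric a x) : IsGenericModel a (closedInd a) x x :=
  ⟨hx, fun _ => rfl, fun _ => id⟩

theorem eventually_halfOpenInd_eq (S : Finset (Fin n)) (x p : Fin d → ℝ) :
    ∀ᶠ t in 𝓝[>] (0 : ℝ), halfOpenInd a p S x = closedInd a S (x + t • (p - x)) := by
  by_cases h : ∀ᶠ t in 𝓝[>] (0 : ℝ), x + t • (p - x) ∈ hull a S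
  · filter_upwards [h] with t ht
    rw [halfOpenInd, closedInd, Set.indicator_of_mem (by exact h), Set.indicator_of_mem ht]
    rfl
  · have hnot : ∀ᶠ t in 𝓝[>] (0 : ℝ), x + t • (p - x) ∉ hull a S := by
      rw [← Filter.not_frequently]
      exact fun hf => h (eventually_add_smul_mem_of_frequently (convex_convexHull ℝ _)
        (isClosed_hull a S) hf)
    filter_upwards [hnot] with t ht
    rw [halfOpenInd, closedInd, Set.indicator_of_notMem (by exact h), Set.indicator_of_notMem ht]

theorem eventually_isGeneric
    (hp : ∀ S : Finset (Fin n), S.card = d → p ∉ affineSpan ℝ (a '' (S : Set (Fin n)))) :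
    ∀ᶠ t in 𝓝[>] (0 : ℝ), IsGeneric a (x + t • (p - x)) := by
  refine Filter.eventually_all.2 fun S => Filter.eventually_imp_distrib_left.2 fun hS => ?_
  filter_upwards [eventually_notMem_affineSubspace _ (hp S hS) x] with t ht hmem
  exact ht (convexHull_subset_affineSpan _ hmem)

theorem mem_hull_of_halfOpenInd_ne_zero {S : Finset (Fin n)} (h : halfOpenInd a p S x ≠ 0) :
    x ∈ hull a S := by
  have hx : x ∈ {x | ∀ᶠ t in 𝓝[>] (0 : ℝ), x + t • (p - x) ∈ hull a S} :=
    Set.mem_of_indicator_ne_zero h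
  exact (isClosed_hull a S).mem_of_tendsto (tendsto_add_smul_nhdsGT x (p - x)) hx

theorem exists_isGenericModel_halfOpenInd (hx : x ∈ hull a Finset.univ)
    (hpA : p ∈ hull a Finset.univ)
    (hp : ∀ S : Finset (Fin n), S.card = d → p ∉ affineSpan ℝ (a '' (S : Set (Fin n)))) :
    ∃ y ∈ hull a Finset.univ, IsGenericModel a (halfOpenInd a p) x y := by
  have heq : ∀ᶠ t in 𝓝[>] (0 : ℝ), ∀ S : Finset (Fin n),
      halfOpenInd a p S x = closedInd a S (x + t • (p - x)) :=
    Filter.eventually_all.2 fun S => eventually_halfOpenInd_eq S x p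
  obtain ⟨t, ⟨heq, hgen⟩, ht⟩ := ((heq.and (eventually_isGeneric hp)).and
    (Ioo_mem_nhdsGT (zero_lt_one' ℝ))).exists
  refine ⟨x + t • (p - x), (convex_convexHull ℝ _).add_smul_sub_mem hx hpA ⟨ht.1.le, ht.2.le⟩,
    hgen, heq, fun B hB => mem_hull_of_halfOpenInd_ne_zero (p := p) ?_⟩
  rw [heq B, closedInd, Set.indicator_of_mem hB]
  exact one_ne_zero

end GenericPoints

section Tiles

variable {F G T T' : Finset (Fin n) × Finset (Fin n)} {b : Fin n}
  {P : Finset (Finset (Fin n) × Finset (Fin n))} {z : Fin (d + 1) → ℝ}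

theorem zonotope_eq_tile (a : Fin n → Fin d → ℝ) : zonotope a = tile a (∅, Finset.univ) := by
  simp only [zonotope, tile, Finset.sum_empty, zero_add]

/-- The coefficient of `v_b` in the expansion of a point of the tile `T = (I, B)` as
`∑_{i ∈ I} v_i + ∑_{b ∈ B} α_b v_b`. -/
def tileCoord (a : Fin n → Fin d → ℝ) (T : Finset (Fin n) × Finset (Fin n)) (b : Fin n)
    (z : Fin (d + 1) → ℝ) : ℝ :=
  coordForm a T.2 b (z - ∑ i ∈ T.1, lift (a i))

theorem tileCoord_add_smul (z w : Fin (d + 1) → ℝ) (t : ℝ) :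
    tileCoord a T b (z + t • w) = tileCoord a T b z + t * coordForm a T.2 b w := by
  rw [tileCoord, tileCoord, add_sub_right_comm, map_add, map_smul, smul_eq_mul]

theorem mem_tile_iff (hB : IsBasis a T.2) :
    z ∈ tile a T ↔ ∀ b ∈ T.2, tileCoord a T b z ∈ Set.Icc (0 : ℝ) 1 := by
  constructor
  · rintro ⟨α, hα, rfl⟩ b hb
    rw [tileCoord, add_sub_cancel_left, hB.coordForm_sum hb subset_rfl, if_pos hb]
    exact hα b
  · refine fun h => ⟨fun b => if b ∈ T.2 then tileCoord a T b z else 0, fun b => ?_, ?_⟩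
    · beta_reduce
      split_ifs with hb
      · exact h b hb
      · exact Set.left_mem_Icc.2 zero_le_one
    · simp only [ite_smul, zero_smul, Finset.sum_ite_mem, Finset.inter_self, tileCoord,
        hB.sum_coordForm, add_sub_cancel]

theorem isClosed_tile (hB : IsBasis a T.2) : IsClosed (tile a T) := by
  have htile : tile a T = ⋂ b ∈ T.2, tileCoord a T b ⁻¹' Set.Icc (0 : ℝ) 1 := by
    ext z
    simp only [mem_tile_iff hB, Set.mem_iInter, Set.mem_preimage]
  rw [htile]
  refine isClosed_biInter fun b _ => isClosed_Icc.preimage ?_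
  exact (coordForm a T.2 b).continuous_of_finiteDimensional.comp (by fun_prop)

theorem IsFace.tileCoord_eq (hF : IsFace F T) (hB : IsBasis a T.2) (hd : Disjoint T.1 T.2)
    (hb : b ∈ T.2) (α : Fin n → ℝ) :
    tileCoord a T b (∑ i ∈ F.1, lift (a i) + ∑ c ∈ F.2, α c • lift (a c)) =
      if b ∈ F.2 then α b else if b ∈ F.1 then 1 else 0 := by
  obtain ⟨hF2, hTF, hF1⟩ := hF
  have hbT : b ∉ T.1 := Finset.disjoint_right.1 hd hb
  have hsub : F.1 \ T.1 ⊆ T.2 := by grind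
  have hvertex : ∑ i ∈ F.1, lift (a i) - ∑ i ∈ T.1, lift (a i) =
      ∑ i ∈ F.1 \ T.1, (1 : ℝ) • lift (a i) := by
    simp only [one_smul, Finset.sum_sdiff_eq_sub hTF]
  rw [tileCoord, add_sub_right_comm, hvertex, map_add, hB.coordForm_sum hb hF2,
    hB.coordForm_sum (w := fun _ => 1) hb hsub]
  by_cases hbF2 : b ∈ F.2
  · have hbF1 : b ∉ F.1 := by grind
    simp [hbF1, hbF2]
  · simp [hbF2, hbT]

theorem IsFace.tileCoord_of_mem (hF : IsFace F T) (hB : IsBasis a T.2) (hd : Disjoint T.1 T.2)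
    (hz : z ∈ tile a F) (hb : b ∈ T.2) (hbF : b ∉ F.2) :
    tileCoord a T b z = if b ∈ F.1 then 1 else 0 := by
  obtain ⟨α, -, rfl⟩ := hz
  rw [hF.tileCoord_eq hB hd hb, if_neg hbF]

theorem IsFace.eq_of_snd_eq (hF : IsFace F T) (hF' : IsFace F T') (hB : IsBasis a T.2)
    (hB' : IsBasis a T'.2) (h : F.2 = T.2) : T = T' := by
  have h' : F.2 = T'.2 := Finset.eq_of_subset_of_card_le hF'.1 (by rw [h, hB.1, hB'.1])
  have hfst : ∀ {T}, IsFace F T → F.2 = T.2 → F.1 = T.1 := fun hF h => by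
    have := hF.2.2
    rw [h, Finset.sdiff_self, Finset.union_empty] at this
    exact this.antisymm hF.2.1
  exact Prod.ext ((hfst hF h).symm.trans (hfst hF' h')) (h.symm.trans h')

theorem IsFace.trans (hGF : IsFace G F) (hFT : IsFace F T) : IsFace G T := by
  obtain ⟨hG2, hFG, hG1⟩ := hGF
  obtain ⟨hF2, hTF, hF1⟩ := hFT
  refine ⟨hG2.trans hF2, hTF.trans hFG, fun i hi => ?_⟩
  grind

/-- The barycentre of the parallelepiped `Π_{J,C}`, where `F = (J, C)`. -/
def barycentre (a : Fin n → Fin d → ℝ) (F : Finset (Fin n) × Finset (Fin n)) :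
    Fin (d + 1) → ℝ :=
  ∑ i ∈ F.1, lift (a i) + ∑ c ∈ F.2, (1 / 2 : ℝ) • lift (a c)

theorem IsFace.tileCoord_barycentre (hF : IsFace F T) (hB : IsBasis a T.2)
    (hd : Disjoint T.1 T.2) (hb : b ∈ T.2) :
    tileCoord a T b (barycentre a F) = if b ∈ F.2 then 1 / 2 else if b ∈ F.1 then 1 else 0 :=
  hF.tileCoord_eq hB hd hb _

theorem barycentre_mem_tile : barycentre a F ∈ tile a F :=
  ⟨fun _ => 1 / 2, fun _ => by norm_num, rfl⟩

theorem IsFace.tile_subset (hF : IsFace F T) (hB : IsBasis a T.2) (hd : Disjoint T.1 T.2) :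
    tile a F ⊆ tile a T := by
  rintro z ⟨α, hα, rfl⟩
  refine (mem_tile_iff hB).2 fun b hb => ?_
  rw [hF.tileCoord_eq hB hd hb]
  split_ifs
  · exact hα b
  · exact Set.right_mem_Icc.2 zero_le_one
  · exact Set.left_mem_Icc.2 zero_le_one

theorem IsFace.of_barycentre_mem (hG : IsFace G T) (hF : IsFace F T) (hB : IsBasis a T.2)
    (hd : Disjoint T.1 T.2) (hGF : barycentre a G ∈ tile a F) : IsFace G F := by
  have hcoord : ∀ b ∈ T.2, b ∉ F.2 → b ∉ G.2 ∧ (b ∈ G.1 ↔ b ∈ F.1) := fun b hb hbF => by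
    have h := hF.tileCoord_of_mem hB hd hGF hb hbF
    rw [hG.tileCoord_barycentre hB hd hb] at h
    split_ifs at h <;> norm_num at h <;> tauto
  obtain ⟨hG2, hTG, hG1⟩ := hG
  obtain ⟨-, hTF, hF1⟩ := hF
  have hsub : G.2 ⊆ F.2 := fun b hb => by
    by_contra hbF
    exact (hcoord b (hG2 hb) hbF).1 hb
  refine ⟨hsub, fun i hi => ?_, fun i hi => ?_⟩
  · grind
  · grind

theorem IsFineZonotopalTiling.exists_face (hP : IsFineZonotopalTiling a P) (hT : T ∈ P)
    (hT' : T' ∈ P) (hz : z ∈ tile a T) (hz' : z ∈ tile a T') :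
    ∃ F, IsFace F T ∧ IsFace F T' ∧ z ∈ tile a F := by
  obtain h | ⟨F, hF, hF', h⟩ := hP.inter T hT T' hT'
  · exact absurd h (Set.Nonempty.ne_empty ⟨z, hz, hz'⟩)
  · exact ⟨F, hF, hF', h ▸ ⟨hz, hz'⟩⟩

theorem IsFineZonotopalTiling.eq_of_tileCoord_mem_Ioo (hP : IsFineZonotopalTiling a P)
    (hT : T ∈ P) (hT' : T' ∈ P) (hz : ∀ b ∈ T.2, tileCoord a T b z ∈ Set.Ioo (0 : ℝ) 1)
    (hz' : z ∈ tile a T') : T = T' := by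
  have hB := hP.basis T hT
  obtain ⟨F, hF, hF', hzF⟩ := hP.exists_face hT hT'
    ((mem_tile_iff hB).2 fun b hb => Set.Ioo_subset_Icc_self (hz b hb)) hz'
  refine hF.eq_of_snd_eq hF' hB (hP.basis T' hT') (hF.1.antisymm fun b hb => ?_)
  by_contra hbF
  have hbz := hz b hb
  rw [hF.tileCoord_of_mem hB (hP.disjoint T hT) hzF hb hbF] at hbz
  split_ifs at hbz
  · exact lt_irrefl _ hbz.2
  · exact lt_irrefl _ hbz.1

theorem IsFineZonotopalTiling.isFace_of_barycentre_mem (hP : IsFineZonotopalTiling a P)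
    (hT : T ∈ P) (hT' : T' ∈ P) (hG : IsFace G T) (hGT' : barycentre a G ∈ tile a T') :
    IsFace G T' := by
  have hB := hP.basis T hT
  have hd := hP.disjoint T hT
  obtain ⟨F, hF, hF', hGF⟩ :=
    hP.exists_face hT hT' (hG.tile_subset hB hd barycentre_mem_tile) hGT'
  exact (hG.of_barycentre_mem hF hB hd hGF).trans hF'

theorem smul_lift_mem_tile_iff {y : Fin d → ℝ} {c : ℝ} (hc0 : 0 < c) (hc1 : c < 1) :
    c • lift y ∈ tile a T ↔ T.1 = ∅ ∧ y ∈ hull a T.2 := by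
  constructor
  · rintro ⟨α, hα, h⟩
    have hT1 : T.1 = ∅ := by
      have hlast := congrFun h (Fin.last d)
      simp only [lift, Pi.smul_apply, Pi.add_apply, Finset.sum_apply, Fin.snoc_last, smul_eq_mul,
        mul_one, Finset.sum_const, nsmul_eq_mul] at hlast
      have hcard : (T.1.card : ℝ) < 1 := by
        linarith [Finset.sum_nonneg fun i (_ : i ∈ T.2) => (hα i).1]
      exact Finset.card_eq_zero.1 (Nat.lt_one_iff.1 (by exact_mod_cast hcard))
    refine ⟨hT1, (mem_hull_iff subset_rfl).2 ⟨fun i => c⁻¹ * α i, fun i _ =>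
      mul_nonneg (inv_nonneg.2 hc0.le) (hα i).1, fun i hi hi' => absurd hi hi', ?_⟩⟩
    rw [hT1, Finset.sum_empty, zero_add] at h
    simp only [mul_smul, ← Finset.smul_sum, ← h, inv_smul_smul₀ hc0.ne']
  · rintro ⟨hT1, hy⟩
    obtain ⟨w, hw, hw0, hwy⟩ := (mem_hull_iff (Finset.subset_univ T.2)).1 hy
    have hw1 : ∀ i, w i ≤ 1 := fun i =>
      (sum_smul_lift_eq_lift_iff.1 hwy).2 ▸ Finset.single_le_sum hw (Finset.mem_univ i)
    refine ⟨fun i => c * w i, fun i => ⟨mul_nonneg hc0.le (hw i (Finset.mem_univ i)),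
      mul_le_one₀ hc1.le (hw i (Finset.mem_univ i)) (hw1 i)⟩, ?_⟩
    rw [← Finset.sum_subset (Finset.subset_univ T.2) fun i hi hiT => by
      rw [hw0 i hi hiT, zero_smul]] at hwy
    simp only [hT1, Finset.sum_empty, zero_add, mul_smul, ← Finset.smul_sum, hwy]

theorem IsFineZonotopalTiling.exists_mem_hull (hP : IsFineZonotopalTiling a P) {y : Fin d → ℝ}
    (hy : y ∈ hull a Finset.univ) : ∃ T ∈ P, T.1 = ∅ ∧ y ∈ hull a T.2 := by
  have hZ : (1 / 2 : ℝ) • lift y ∈ zonotope a := by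
    rw [zonotope_eq_tile, smul_lift_mem_tile_iff one_half_pos one_half_lt_one]
    exact ⟨rfl, hy⟩
  rw [← hP.cover, Set.mem_iUnion₂] at hZ
  obtain ⟨T, hT, hyT⟩ := hZ
  exact ⟨T, hT, (smul_lift_mem_tile_iff one_half_pos one_half_lt_one).1 hyT⟩

theorem IsFineZonotopalTiling.eq_of_mem_hull (hP : IsFineZonotopalTiling a P) {y : Fin d → ℝ}
    (hy : IsGeneric a y) (hT : T ∈ P) (hT' : T' ∈ P) (hT1 : T.1 = ∅) (hT'1 : T'.1 = ∅)
    (hyT : y ∈ hull a T.2) (hyT' : y ∈ hull a T'.2) : T = T' := by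
  obtain ⟨F, hF, hF', hyF⟩ := hP.exists_face hT hT'
    ((smul_lift_mem_tile_iff one_half_pos one_half_lt_one).2 ⟨hT1, hyT⟩)
    ((smul_lift_mem_tile_iff one_half_pos one_half_lt_one).2 ⟨hT'1, hyT'⟩)
  have hB := hP.basis T hT
  refine hF.eq_of_snd_eq hF' hB (hP.basis T' hT') ?_
  by_contra hne
  have hlt := Finset.card_lt_card (hF.1.ssubset_of_ne hne)
  have hcard := hB.1
  obtain ⟨S, hFS, -, hS⟩ := Finset.exists_subsuperset_card_eq (n := d) hF.1 (by lia) (by lia)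
  exact hy S hS (hull_mono hFS ((smul_lift_mem_tile_iff one_half_pos one_half_lt_one).1 hyF).2)

theorem IsFineZonotopalTiling.sum_closedInd (hP : IsFineZonotopalTiling a P) {y : Fin d → ℝ}
    (hy : y ∈ hull a Finset.univ) (hgen : IsGeneric a y) :
    ∑ T ∈ P with T.1 = ∅, closedInd a T.2 y = 1 := by
  obtain ⟨T, hT, hT1, hyT⟩ := hP.exists_mem_hull hy
  rw [Finset.sum_eq_single_of_mem T (Finset.mem_filter.2 ⟨hT, hT1⟩), closedInd,
    Set.indicator_of_mem hyT, Pi.one_apply]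
  intro T' hT' hne
  obtain ⟨hT', hT'1⟩ := Finset.mem_filter.1 hT'
  exact Set.indicator_of_notMem
    (fun hyT' => hne (hP.eq_of_mem_hull hgen hT' hT hT'1 hT1 hyT' hyT)) _

end Tiles

section Facets

variable {J C : Finset (Fin n)} {T : Finset (Fin n) × Finset (Fin n)} {b b' i : Fin n}
  {P : Finset (Finset (Fin n) × Finset (Fin n))} {w : Fin (d + 1) → ℝ} {x : Fin d → ℝ}

/-- The label of the tile which has the facet `Π_{J,C}` and the further edge direction `v_b`, where
`b ∉ C`. The facet consists of the points with coefficient `1` of `v_b` if `b ∈ J`, and with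
coefficient `0` otherwise. -/
def adjacentTile (J C : Finset (Fin n)) (b : Fin n) : Finset (Fin n) × Finset (Fin n) :=
  (J.erase b, insert b C)

theorem isFace_adjacentTile (hb : b ∉ C) : IsFace (J, C) (adjacentTile J C b) := by
  refine ⟨Finset.subset_insert b C, Finset.erase_subset b J, fun i hi => ?_⟩
  simp only [adjacentTile]
  grind

theorem exists_eq_adjacentTile (hF : IsFace (J, C) T) (hd : Disjoint T.1 T.2)
    (hcard : T.2.card = C.card + 1) : ∃ b ∉ C, T = adjacentTile J C b := by
  obtain ⟨hC, hTJ, hJ⟩ := hF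
  obtain ⟨b, hb⟩ := Finset.card_eq_one.1
    (show (T.2 \ C).card = 1 by rw [Finset.card_sdiff_of_subset hC]; lia)
  rw [hb] at hJ
  have hbT := Finset.mem_sdiff.1 (hb ▸ Finset.mem_singleton_self b)
  refine ⟨b, hbT.2, Prod.ext ?_ ?_⟩
  · have hbT1 : b ∉ T.1 := Finset.disjoint_right.1 hd hbT.1
    refine Finset.Subset.antisymm (fun i hi => ?_) fun i hi => ?_
    · exact Finset.mem_erase.2 ⟨ne_of_mem_of_not_mem hi hbT1, hTJ hi⟩
    · obtain ⟨hib, hiJ⟩ := Finset.mem_erase.1 hi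
      simpa [hib] using hJ hiJ
  · rw [← Finset.sdiff_union_of_subset hC, hb, adjacentTile, Finset.insert_eq]

/-- The vector `± v_b` pointing from the facet `Π_{J,C}` into the tile `adjacentTile J C b`. -/
def inward (a : Fin n → Fin d → ℝ) (J : Finset (Fin n)) (b : Fin n) : Fin (d + 1) → ℝ :=
  if b ∈ J then -lift (a b) else lift (a b)

theorem abs_facetForm_inward (a : Fin n → Fin d → ℝ) (J C : Finset (Fin n)) (b : Fin n) :
    |facetForm a C (inward a J b)| = |facetForm a C (lift (a b))| := by
  rw [inward]
  split_ifs
  · rw [map_neg, abs_neg]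
  · rfl

theorem facetForm_inward_ne_zero (hb : b ∉ C) (hB : IsBasis a (insert b C)) :
    facetForm a C (inward a J b) ≠ 0 := by
  rw [← abs_pos, abs_facetForm_inward, ← posDet_insert hb]
  exact hB.posDet_pos

theorem coordForm_insert (hb : b ∉ C) (J : Finset (Fin n)) (w : Fin (d + 1) → ℝ) :
    coordForm a (insert b C) b w =
      if b ∈ J then -(facetForm a C w / facetForm a C (inward a J b))
      else facetForm a C w / facetForm a C (inward a J b) := by
  rw [coordForm_apply, Finset.erase_insert hb, inward]
  split_ifs
  · rw [map_neg, div_neg, neg_neg]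
  · rfl

theorem tileCoord_adjacentTile_barycentre_add_smul (hb : b ∉ C) (hB : IsBasis a (insert b C))
    (hd : Disjoint (J.erase b) (insert b C)) (w : Fin (d + 1) → ℝ) (t : ℝ) :
    tileCoord a (adjacentTile J C b) b (barycentre a (J, C) + t • w) =
      if b ∈ J then 1 - t * (facetForm a C w / facetForm a C (inward a J b))
      else t * (facetForm a C w / facetForm a C (inward a J b)) := by
  rw [tileCoord_add_smul, (isFace_adjacentTile hb).tileCoord_barycentre hB hd
    (Finset.mem_insert_self b C), if_neg hb, adjacentTile, coordForm_insert hb J]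
  split_ifs <;> ring

theorem eventually_tileCoord_mem_Ioo (hb : b ∉ C) (hB : IsBasis a (insert b C))
    (hd : Disjoint (J.erase b) (insert b C))
    (hw : 0 < facetForm a C w * facetForm a C (inward a J b)) :
    ∀ᶠ t in 𝓝[>] (0 : ℝ), ∀ c ∈ (adjacentTile J C b).2,
      tileCoord a (adjacentTile J C b) c (barycentre a (J, C) + t • w) ∈ Set.Ioo (0 : ℝ) 1 := by
  refine (Filter.eventually_all_finset _).2 fun c hc => ?_
  obtain rfl | hcC := Finset.mem_insert.1 hc
  · have hr := div_pos_iff.2 (mul_pos_iff.1 hw)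
    filter_upwards [self_mem_nhdsWithin, (tendsto_add_smul_nhdsGT 0
      (facetForm a C w / facetForm a C (inward a J c))).eventually_lt_const zero_lt_one]
      with t ht0 ht1
    rw [zero_add, smul_eq_mul] at ht1
    have ht0 := mul_pos (Set.mem_Ioi.1 ht0) hr
    rw [tileCoord_adjacentTile_barycentre_add_smul hb hB hd]
    split_ifs
    · exact ⟨sub_pos.2 ht1, sub_lt_self 1 ht0⟩
    · exact ⟨ht0, ht1⟩
  · simp only [tileCoord_add_smul, (isFace_adjacentTile hb).tileCoord_barycentre hB hd hc,
      if_pos hcC]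
    exact tendsto_add_smul_nhdsGT (1 / 2) (coordForm a (insert b C) c w)
      (Ioo_mem_nhds one_half_pos one_half_lt_one)

theorem nonneg_of_frequently_mem_adjacentTile (hb : b ∉ C) (hB : IsBasis a (insert b C))
    (hd : Disjoint (J.erase b) (insert b C))
    (h : ∃ᶠ t in 𝓝[>] (0 : ℝ), barycentre a (J, C) + t • w ∈ tile a (adjacentTile J C b)) :
    0 ≤ facetForm a C w * facetForm a C (inward a J b) := by
  obtain ⟨t, hmem, ht⟩ := (h.and_eventually self_mem_nhdsWithin).exists
  have hcoord := (mem_tile_iff hB).1 hmem b (Finset.mem_insert_self b C)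
  rw [tileCoord_adjacentTile_barycentre_add_smul hb hB hd] at hcoord
  refine mul_nonneg_iff.2 (div_nonneg_iff.1 (nonneg_of_mul_nonneg_right ?_ (Set.mem_Ioi.1 ht)))
  split_ifs at hcoord
  · exact (sub_le_self_iff 1).1 hcoord.2
  · exact hcoord.1

/-- The directions `b` for which `P` has a tile with facet `Π_{J,C}` and edge `v_b`. -/
def incidences (P : Finset (Finset (Fin n) × Finset (Fin n))) (J C : Finset (Fin n)) :
    Finset (Fin n) :=
  {b | b ∉ C ∧ adjacentTile J C b ∈ P}

theorem mem_incidences : b ∈ incidences P J C ↔ b ∉ C ∧ adjacentTile J C b ∈ P := by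
  simp only [incidences, Finset.mem_filter_univ]

namespace IsFineZonotopalTiling

theorem facetForm_inward_ne_zero (hP : IsFineZonotopalTiling a P) (hb : b ∈ incidences P J C) :
    facetForm a C (inward a J b) ≠ 0 :=
  have ⟨hbC, hbP⟩ := mem_incidences.1 hb
  ZonotopalSpline.facetForm_inward_ne_zero hbC (hP.basis _ hbP)

theorem eq_of_mem_incidences (hP : IsFineZonotopalTiling a P) (hb : b ∈ incidences P J C)
    (hb' : b' ∈ incidences P J C)
    (h : 0 < facetForm a C (inward a J b) * facetForm a C (inward a J b')) : b = b' := by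
  have hσ := mul_self_pos.2 (hP.facetForm_inward_ne_zero hb)
  obtain ⟨hbC, hbP⟩ := mem_incidences.1 hb
  obtain ⟨hb'C, hb'P⟩ := mem_incidences.1 hb'
  obtain ⟨t, ht, ht'⟩ :=
    ((eventually_tileCoord_mem_Ioo hbC (hP.basis _ hbP) (hP.disjoint _ hbP) hσ).and
      (eventually_tileCoord_mem_Ioo hb'C (hP.basis _ hb'P) (hP.disjoint _ hb'P) h)).exists
  have htile : adjacentTile J C b = adjacentTile J C b' := hP.eq_of_tileCoord_mem_Ioo hbP hb'P ht
    ((mem_tile_iff (hP.basis _ hb'P)).2 fun c hc => Set.Ioo_subset_Icc_self (ht' c hc))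
  have hmem : b ∈ insert b' C := (congrArg Prod.snd htile).le (Finset.mem_insert_self b C)
  exact (Finset.mem_insert.1 hmem).resolve_right hbC

theorem exists_frequently_mem_tile (hP : IsFineZonotopalTiling a P) {z : Fin (d + 1) → ℝ}
    (hZ : ∀ᶠ t in 𝓝[>] (0 : ℝ), z + t • w ∈ zonotope a) :
    ∃ T ∈ P, z ∈ tile a T ∧ ∃ᶠ t in 𝓝[>] (0 : ℝ), z + t • w ∈ tile a T := by
  suffices h : ∃ T ∈ P, ∃ᶠ t in 𝓝[>] (0 : ℝ), z + t • w ∈ tile a T by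
    obtain ⟨T, hT, hfreq⟩ := h
    exact ⟨T, hT, (isClosed_tile (hP.basis T hT)).mem_of_frequently_of_tendsto hfreq
      (tendsto_add_smul_nhdsGT z w), hfreq⟩
  by_contra! hnot
  obtain ⟨t, htZ, htP⟩ := (hZ.and ((Filter.eventually_all_finset P).2 hnot)).exists
  rw [← hP.cover, Set.mem_iUnion₂] at htZ
  obtain ⟨T, hT, htT⟩ := htZ
  exact htP T hT htT

theorem exists_mem_incidences_nonneg (hP : IsFineZonotopalTiling a P)
    (hb : b ∈ incidences P J C)
    (hZ : ∀ᶠ t in 𝓝[>] (0 : ℝ), barycentre a (J, C) + t • w ∈ zonotope a) :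
    ∃ b' ∈ incidences P J C, 0 ≤ facetForm a C w * facetForm a C (inward a J b') := by
  obtain ⟨hbC, hbP⟩ := mem_incidences.1 hb
  obtain ⟨T, hT, hmem, hfreq⟩ := hP.exists_frequently_mem_tile hZ
  have hcard : T.2.card = C.card + 1 := by
    rw [(hP.basis T hT).1, ← (hP.basis _ hbP).1, adjacentTile, Finset.card_insert_of_notMem hbC]
  obtain ⟨b', hb'C, rfl⟩ := exists_eq_adjacentTile
    (hP.isFace_of_barycentre_mem hbP hT (isFace_adjacentTile hbC) hmem) (hP.disjoint T hT) hcard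
  exact ⟨b', mem_incidences.2 ⟨hb'C, hT⟩,
    nonneg_of_frequently_mem_adjacentTile hb'C (hP.basis _ hT) (hP.disjoint _ hT) hfreq⟩

end IsFineZonotopalTiling

theorem eventually_barycentre_add_smul_inward_mem_zonotope (hJC : Disjoint J C) (hi : i ∉ C) :
    ∀ᶠ t in 𝓝[>] (0 : ℝ), barycentre a (J, C) + t • inward a J i ∈ zonotope a := by
  filter_upwards [Ioo_mem_nhdsGT (zero_lt_one' ℝ)] with t ht
  refine ⟨fun j => (if j ∈ J then 1 else 0) + (if j ∈ C then 1 / 2 else 0) +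
    if j = i then (if i ∈ J then -t else t) else 0, fun j => ?_, ?_⟩
  · have hj : j ∈ J → j ∉ C := fun hj => Finset.disjoint_left.1 hJC hj
    obtain ⟨ht0, ht1⟩ := ht
    beta_reduce
    split_ifs <;> constructor <;> grind
  · simp only [add_smul, Finset.sum_add_distrib, ite_smul, zero_smul, one_smul,
      Finset.sum_ite_mem, Finset.univ_inter, Finset.sum_ite_eq', Finset.mem_univ, if_true,
      barycentre, inward, neg_smul, smul_ite, smul_neg]

/-- If the inward vectors were all on one side of the hyperplane, the form of `C` would be
nonnegative at `x` because of the points outside `J` and nonpositive because of those in `J ∪ C`. -/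
theorem exists_mul_facetForm_inward_neg (hx : x ∈ hull a Jᶜ) (hxJC : x ∈ hull a (J ∪ C))
    (hxC : facetForm a C (lift x) ≠ 0) {s : ℝ} (hs : s ≠ 0) :
    ∃ i ∉ C, s * facetForm a C (inward a J i) < 0 := by
  by_contra! hnonneg
  have hle : 0 ≤ (s • facetForm a C) (lift x) := by
    refine map_lift_nonneg_of_mem_hull hx _ fun i hi => ?_
    rw [LinearMap.smul_apply, smul_eq_mul]
    by_cases hiC : i ∈ C
    · rw [facetForm_lift_of_mem hiC, mul_zero]
    · simpa only [inward, if_neg (Finset.mem_compl.1 hi)] using hnonneg i hiC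
  have hge : 0 ≤ (-(s • facetForm a C)) (lift x) := by
    refine map_lift_nonneg_of_mem_hull hxJC _ fun i hi => ?_
    rw [LinearMap.neg_apply, LinearMap.smul_apply, smul_eq_mul]
    by_cases hiC : i ∈ C
    · rw [facetForm_lift_of_mem hiC, mul_zero, neg_zero]
    · simpa only [inward, if_pos ((Finset.mem_union.1 hi).resolve_right hiC), map_neg, mul_neg]
        using hnonneg i hiC
  rw [LinearMap.neg_apply, neg_nonneg] at hge
  exact mul_ne_zero hs hxC (hge.antisymm hle)

/-- The contributions of the tiles incident to a facet cancel, unless the facet lies in the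
boundary of the zonotope and does not contribute at `x`. -/
theorem IsFineZonotopalTiling.sum_sign_facetForm_inward (hP : IsFineZonotopalTiling a P)
    (hx : x ∈ hull a Jᶜ) (hxJC : x ∈ hull a (J ∪ C)) (hxC : facetForm a C (lift x) ≠ 0) :
    ∑ b ∈ incidences P J C, (SignType.sign (facetForm a C (inward a J b)) : ℝ) = 0 := by
  refine sum_sign_eq_zero (fun b hb b' hb' => hP.eq_of_mem_incidences hb hb') fun b hb hσ => ?_
  obtain ⟨hbC, hbP⟩ := mem_incidences.1 hb
  obtain ⟨i, hiC, hi⟩ := exists_mul_facetForm_inward_neg hx hxJC hxC hσ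
  have hJC : Disjoint J C := by
    refine Finset.disjoint_left.2 fun j hjJ hjC => ?_
    exact Finset.disjoint_left.1 (hP.disjoint _ hbP)
      (Finset.mem_erase.2 ⟨ne_of_mem_of_not_mem hjC hbC, hjJ⟩) (Finset.mem_insert_of_mem hjC)
  obtain ⟨b', hb', hnonneg⟩ := hP.exists_mem_incidences_nonneg hb
    (eventually_barycentre_add_smul_inward_mem_zonotope hJC hiC)
  refine ⟨b', hb', ?_⟩
  have hpos := hnonneg.lt_of_ne'
    (mul_ne_zero (right_ne_zero_of_mul hi.ne) (hP.facetForm_inward_ne_zero hb'))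
  refine neg_of_mul_neg_left (b := facetForm a C (inward a J i) ^ 2) ?_ (sq_nonneg _)
  linear_combination mul_neg_of_neg_of_pos hi hpos

end Facets

section FacetSums

variable {P : Finset (Finset (Fin n) × Finset (Fin n))} {M : Type*} [AddCommMonoid M]

theorem sum_incidences_notMem (hP : ∀ T ∈ P, Disjoint T.1 T.2)
    (g : Finset (Fin n) × Finset (Fin n) → Fin n → M) :
    ∑ F : Finset (Fin n) × Finset (Fin n), ∑ b ∈ incidences P F.1 F.2 with b ∉ F.1, g F b =
      ∑ T ∈ P, ∑ b ∈ T.2, g (T.1, T.2.erase b) b := by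
  rw [Finset.sum_sigma', Finset.sum_sigma']
  refine Finset.sum_bij' (fun p _ => ⟨adjacentTile p.1.1 p.1.2 p.2, p.2⟩)
    (fun p _ => ⟨(p.1.1, p.1.2.erase p.2), p.2⟩) ?_ ?_ ?_ ?_ ?_
  · rintro ⟨⟨J, C⟩, b⟩ h
    have hb := (Finset.mem_filter.1 (Finset.mem_sigma.1 h).2).1
    exact Finset.mem_sigma.2 ⟨(mem_incidences.1 hb).2, Finset.mem_insert_self b C⟩
  · rintro ⟨⟨I, B⟩, b⟩ h
    obtain ⟨hT, hb⟩ := Finset.mem_sigma.1 h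
    have hbI : b ∉ I := Finset.disjoint_right.1 (hP _ hT) hb
    simp_all [mem_incidences, adjacentTile]
  · rintro ⟨⟨J, C⟩, b⟩ h
    simp_all [mem_incidences, adjacentTile]
  · rintro ⟨⟨I, B⟩, b⟩ h
    obtain ⟨hT, hb⟩ := Finset.mem_sigma.1 h
    have hbI : b ∉ I := Finset.disjoint_right.1 (hP _ hT) hb
    simp_all [adjacentTile]
  · rintro ⟨⟨J, C⟩, b⟩ h
    simp_all [mem_incidences, adjacentTile]

theorem sum_incidences_mem (hP : ∀ T ∈ P, Disjoint T.1 T.2)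
    (g : Finset (Fin n) × Finset (Fin n) → Fin n → M) :
    ∑ F : Finset (Fin n) × Finset (Fin n), ∑ b ∈ incidences P F.1 F.2 with b ∈ F.1, g F b =
      ∑ T ∈ P, ∑ b ∈ T.2, g (insert b T.1, T.2.erase b) b := by
  rw [Finset.sum_sigma', Finset.sum_sigma']
  refine Finset.sum_bij' (fun p _ => ⟨adjacentTile p.1.1 p.1.2 p.2, p.2⟩)
    (fun p _ => ⟨(insert p.2 p.1.1, p.1.2.erase p.2), p.2⟩) ?_ ?_ ?_ ?_ ?_
  · rintro ⟨⟨J, C⟩, b⟩ h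
    have hb := (Finset.mem_filter.1 (Finset.mem_sigma.1 h).2).1
    exact Finset.mem_sigma.2 ⟨(mem_incidences.1 hb).2, Finset.mem_insert_self b C⟩
  · rintro ⟨⟨I, B⟩, b⟩ h
    obtain ⟨hT, hb⟩ := Finset.mem_sigma.1 h
    have hbI : b ∉ I := Finset.disjoint_right.1 (hP _ hT) hb
    simp_all [mem_incidences, adjacentTile]
  · rintro ⟨⟨J, C⟩, b⟩ h
    simp_all [mem_incidences, adjacentTile]
  · rintro ⟨⟨I, B⟩, b⟩ h
    obtain ⟨hT, hb⟩ := Finset.mem_sigma.1 h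
    have hbI : b ∉ I := Finset.disjoint_right.1 (hP _ hT) hb
    simp_all [adjacentTile]
  · rintro ⟨⟨J, C⟩, b⟩ h
    simp_all [mem_incidences, adjacentTile]

theorem sum_incidences (hP : ∀ T ∈ P, Disjoint T.1 T.2)
    (g : Finset (Fin n) × Finset (Fin n) → Fin n → M) :
    ∑ F : Finset (Fin n) × Finset (Fin n), ∑ b ∈ incidences P F.1 F.2, g F b =
      ∑ T ∈ P, ∑ b ∈ T.2, (g (T.1, T.2.erase b) b + g (insert b T.1, T.2.erase b) b) := by
  simp only [Finset.sum_add_distrib]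
  rw [← sum_incidences_notMem hP, ← sum_incidences_mem hP, ← Finset.sum_add_distrib]
  refine Finset.sum_congr rfl fun F _ => ?_
  rw [add_comm, Finset.sum_filter_add_sum_filter_not]

end FacetSums

section SymmMultiaffine

/-- `Q` is symmetric and affine in each of its arguments: a polar form, without reference to the
polynomial on the diagonal. -/
structure IsSymmMultiaffine {k : ℕ} (Q : (Fin k → Fin d → ℝ) → ℝ) : Prop where
  symm : ∀ (π : Equiv.Perm (Fin k)) (y : Fin k → Fin d → ℝ), Q (y ∘ π) = Q y
  affine : ∀ (y : Fin k → Fin d → ℝ) (j : Fin k),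
    ∃ f : (Fin d → ℝ) →ᵃ[ℝ] ℝ, ∀ z, Q (Function.update y j z) = f z

theorem IsPolarForm.isSymmMultiaffine {k : ℕ} {q : MvPolynomial (Fin d) ℝ}
    {Q : (Fin k → Fin d → ℝ) → ℝ} (hQ : IsPolarForm k q Q) : IsSymmMultiaffine Q :=
  ⟨hQ.symm, hQ.affine⟩

theorem polarAt_of_card_ne {k : ℕ} {Q : (Fin k → Fin d → ℝ) → ℝ} {I : Finset (Fin n)}
    (hI : I.card ≠ k) : polarAt a Q I = 0 :=
  dif_neg hI

namespace IsSymmMultiaffine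

variable {k : ℕ} {Q : (Fin (k + 1) → Fin d → ℝ) → ℝ} {I B : Finset (Fin n)} {b : Fin n}
  {w : Fin n → ℝ} {x : Fin d → ℝ}

theorem cons (hQ : IsSymmMultiaffine Q) (x : Fin d → ℝ) :
    IsSymmMultiaffine fun y : Fin k → Fin d → ℝ => Q (Fin.cons x y) where
  symm π y := by
    rw [← hQ.symm (Equiv.Perm.decomposeFin.symm (0, π)) (Fin.cons x y)]
    exact congrArg Q (funext (Fin.cases (by simp) fun j => by simp))
  affine y j := by
    obtain ⟨f, hf⟩ := hQ.affine (Fin.cons x y) j.succ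
    exact ⟨f, fun z => by rw [← hf, Fin.cons_update]⟩

theorem polarAt_insert (hQ : IsSymmMultiaffine Q) (hb : b ∉ I) :
    polarAt a Q (insert b I) = polarAt a (fun y => Q (Fin.cons (a b) y)) I := by
  have hcard : (insert b I).card = k + 1 ↔ I.card = k := by
    rw [Finset.card_insert_of_notMem hb, Nat.add_right_cancel_iff]
  by_cases hI : I.card = k
  · obtain ⟨σ, hσ⟩ := exists_perm_cons_orderEmbOfFin hb hI (hcard.2 hI)
    rw [polarAt, dif_pos (hcard.2 hI), polarAt, dif_pos hI, ← hQ.symm σ]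
    change Q (a ∘ (insert b I).orderEmbOfFin _ ∘ σ) = _
    rw [← hσ, Fin.comp_cons]
    rfl
  · rw [polarAt_of_card_ne hI, polarAt_of_card_ne (hcard.not.2 hI)]

theorem sum_cons (hQ : IsSymmMultiaffine Q) (hw : ∑ b ∈ B, w b • lift (a b) = lift x)
    (y : Fin k → Fin d → ℝ) : ∑ b ∈ B, w b * Q (Fin.cons (a b) y) = Q (Fin.cons x y) := by
  obtain ⟨f, hf⟩ := hQ.affine (Fin.cons 0 y) 0
  simp only [Fin.update_cons_zero] at hf
  obtain ⟨hx, hw⟩ := sum_smul_lift_eq_lift_iff.1 hw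
  simp only [hf]
  rw [← hx, ← Finset.affineCombination_eq_linear_combination B a w hw,
    Finset.map_affineCombination B a w hw f,
    Finset.affineCombination_eq_linear_combination _ _ _ hw]
  simp only [Function.comp_apply, smul_eq_mul]

theorem sum_polarAt_insert (hQ : IsSymmMultiaffine Q) (hIB : Disjoint I B)
    (hw : ∑ b ∈ B, w b • lift (a b) = lift x) :
    ∑ b ∈ B, w b * polarAt a Q (insert b I) = polarAt a (fun y => Q (Fin.cons x y)) I := by
  rw [Finset.sum_congr rfl fun b hb => by
    rw [hQ.polarAt_insert (Finset.disjoint_right.1 hIB hb)]]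
  by_cases hI : I.card = k
  · simp only [polarAt, dif_pos hI, hQ.sum_cons hw]
  · simp only [polarAt_of_card_ne hI, mul_zero, Finset.sum_const_zero]

end IsSymmMultiaffine

end SymmMultiaffine

section Reproduction

variable {P : Finset (Finset (Fin n) × Finset (Fin n))} {J B : Finset (Fin n)} {b : Fin n}
  {k : ℕ} {x y : Fin d → ℝ} {χ : Finset (Fin n) → (Fin d → ℝ) → ℝ}
  {sel : Finset (Fin n) → Finset (Fin n)}

theorem mem_hull_compl_of_mem_chk (hx : x ∈ chk a k) (hJ : J.card = k) : x ∈ hull a Jᶜ :=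
  hx _ (by rw [← hJ, add_comm, Finset.card_add_card_compl, Fintype.card_fin])

theorem chk_subset_hull_univ (hk : k ≤ n) : chk a k ⊆ hull a Finset.univ := fun x hx => by
  obtain ⟨J, -, hJ⟩ := Finset.exists_subset_card_eq (s := (Finset.univ : Finset (Fin n)))
    (by simpa using hk)
  exact hull_mono (Finset.subset_univ _) (mem_hull_compl_of_mem_chk hx hJ)

theorem chk_succ_subset (hk : k + 1 ≤ n) : chk a (k + 1) ⊆ chk a k := fun x hx S hS => by
  obtain ⟨i, hi⟩ : S.Nonempty := Finset.card_pos.1 (by lia)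
  refine hull_mono (Finset.erase_subset i S) (hx _ ?_)
  have := Finset.card_erase_add_one hi
  lia

theorem posDet_mul_detQuot (hb : b ∈ B) (x : Fin d → ℝ) :
    posDet a B * detQuot a B b x = facetForm a (B.erase b) (lift x) *
      (SignType.sign (facetForm a (B.erase b) (lift (a b))) : ℝ) := by
  rw [posDet_eq_of_mem hb, detQuot_eq_coordForm hb, coordForm_apply, mul_div_left_comm]
  congr 1
  rcases lt_trichotomy (facetForm a (B.erase b) (lift (a b))) 0 with h | h | h
  · rw [abs_of_neg h, sign_neg h, neg_div, div_self h.ne, SignType.coe_neg_one]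
  · rw [h, abs_zero, zero_div, sign_zero, SignType.coe_zero]
  · rw [abs_of_pos h, sign_pos h, div_self h.ne', SignType.coe_one]

/-- The contribution of the tile `adjacentTile F.1 F.2 b` at its facet `F`. -/
def flux (a : Fin n → Fin d → ℝ) (x : Fin d → ℝ) (R M : Finset (Fin n) → ℝ)
    (F : Finset (Fin n) × Finset (Fin n)) (b : Fin n) : ℝ :=
  R F.1 * M (F.1 ∪ F.2) * facetForm a F.2 (lift x) *
    (SignType.sign (facetForm a F.2 (inward a F.1 b)) : ℝ)

theorem flux_erase (hb : b ∈ B) (hbJ : b ∉ J) (R M : Finset (Fin n) → ℝ) :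
    flux a x R M (J, B.erase b) b =
      R J * posDet a B * (detQuot a B b x * M ((J ∪ B).erase b)) := by
  rw [flux, inward, if_neg hbJ, Finset.erase_union_distrib, Finset.erase_eq_of_notMem hbJ]
  linear_combination -R J * M (J ∪ B.erase b) * posDet_mul_detQuot (a := a) hb x

theorem flux_insert_erase (hb : b ∈ B) (J : Finset (Fin n)) (R M : Finset (Fin n) → ℝ) :
    flux a x R M (insert b J, B.erase b) b =
      -(posDet a B * M (J ∪ B) * (detQuot a B b x * R (insert b J))) := by
  have hunion : insert b J ∪ B.erase b = J ∪ B := by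
    rw [Finset.insert_union, ← Finset.union_insert, Finset.insert_erase hb]
  rw [flux, inward, if_pos (Finset.mem_insert_self b J), hunion, map_neg, Left.sign_neg,
    SignType.coe_neg]
  linear_combination R (insert b J) * M (J ∪ B) * posDet_mul_detQuot (a := a) hb x

theorem IsFineZonotopalTiling.sum_flux (hP : IsFineZonotopalTiling a P) (hx : x ∈ chk a k)
    {R M : Finset (Fin n) → ℝ} (hR : ∀ J, J.card ≠ k → R J = 0)
    (hM : ∀ X, M X ≠ 0 → x ∈ hull a X) (F : Finset (Fin n) × Finset (Fin n)) :
    ∑ b ∈ incidences P F.1 F.2, flux a x R M F b = 0 := by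
  simp only [flux]
  rw [← Finset.mul_sum]
  by_cases hJ : F.1.card = k
  · by_cases hX : M (F.1 ∪ F.2) = 0
    · rw [hX, mul_zero, zero_mul, zero_mul]
    by_cases hC : facetForm a F.2 (lift x) = 0
    · rw [hC, mul_zero, zero_mul]
    rw [hP.sum_sign_facetForm_inward (mem_hull_compl_of_mem_chk hx hJ) (hM _ hX) hC, mul_zero]
  · rw [hR _ hJ, zero_mul, zero_mul, zero_mul]

theorem IsFineZonotopalTiling.sum_mul_sum_detQuot (hP : IsFineZonotopalTiling a P)
    (hx : x ∈ chk a k) {R M : Finset (Fin n) → ℝ} (hR : ∀ J, J.card ≠ k → R J = 0)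
    (hM : ∀ X, M X ≠ 0 → x ∈ hull a X) :
    ∑ T ∈ P, R T.1 * posDet a T.2 * ∑ b ∈ T.2, detQuot a T.2 b x * M ((T.1 ∪ T.2).erase b) =
      ∑ T ∈ P, posDet a T.2 * M (T.1 ∪ T.2) *
        ∑ b ∈ T.2, detQuot a T.2 b x * R (insert b T.1) := by
  rw [← sub_eq_zero, ← Finset.sum_sub_distrib,
    ← Finset.sum_eq_zero fun F (_ : F ∈ Finset.univ) => hP.sum_flux hx hR hM F,
    sum_incidences hP.disjoint]
  refine Finset.sum_congr rfl fun T hT => ?_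
  rw [Finset.mul_sum, Finset.mul_sum, ← Finset.sum_sub_distrib]
  refine Finset.sum_congr rfl fun b hb => ?_
  rw [flux_erase hb (Finset.disjoint_right.1 (hP.disjoint T hT) hb), flux_insert_erase hb,
    sub_eq_add_neg]

theorem IsFineZonotopalTiling.sum_polarAt_spline_zero (hP : IsFineZonotopalTiling a P)
    (hχ : ∑ T ∈ P with T.1 = ∅, χ T.2 x = 1) (sel : Finset (Fin n) → Finset (Fin n))
    (Q : (Fin 0 → Fin d → ℝ) → ℝ) :
    ∑ T ∈ P, polarAt a Q T.1 * posDet a T.2 * spline a χ sel 0 (T.1 ∪ T.2) x =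
      d.factorial * Q fun _ => x := by
  have hterm : ∀ T ∈ P, polarAt a Q T.1 * posDet a T.2 * spline a χ sel 0 (T.1 ∪ T.2) x =
      if T.1 = ∅ then (d.factorial * Q fun _ => x) * χ T.2 x else 0 := fun T hT => by
    split_ifs with hT1
    · have hpos := (hP.basis T hT).posDet_pos.ne'
      rw [hT1, Finset.empty_union, spline, if_pos (hP.basis T hT), polarAt,
        dif_pos Finset.card_empty, Subsingleton.elim (fun j => a _) fun _ => x]
      field_simp
    · rw [polarAt_of_card_ne (Finset.card_eq_zero.not.2 hT1), zero_mul, zero_mul]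
  rw [Finset.sum_congr rfl hterm, ← Finset.sum_filter, ← Finset.mul_sum, hχ, mul_one]

theorem IsFineZonotopalTiling.sum_polarAt_spline_succ (hP : IsFineZonotopalTiling a P)
    (hsel : IsSelection a sel)
    (hR : RespectsRelations (fun i => lift (a i)) fun X => spline a χ sel k X x)
    (hχ : ∀ B, χ B x ≠ 0 → x ∈ hull a B) (hx : x ∈ chk a (k + 1))
    {Q : (Fin (k + 1) → Fin d → ℝ) → ℝ} (hQ : IsSymmMultiaffine Q) :
    ∑ T ∈ P, polarAt a Q T.1 * posDet a T.2 * spline a χ sel (k + 1) (T.1 ∪ T.2) x =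
      ((k + 1 + d : ℕ) : ℝ) / ((k + 1 : ℕ) : ℝ) *
        ∑ T ∈ P, polarAt a (fun y => Q (Fin.cons x y)) T.1 * posDet a T.2 *
          spline a χ sel k (T.1 ∪ T.2) x := by
  have hspline : ∀ T ∈ P, spline a χ sel (k + 1) (T.1 ∪ T.2) x =
      ((k + 1 + d : ℕ) : ℝ) / ((k + 1 : ℕ) : ℝ) *
        ∑ b ∈ T.2, detQuot a T.2 b x * spline a χ sel k ((T.1 ∪ T.2).erase b) x := fun T hT => by
    rw [spline_succ (ν := fun b => if b ∈ T.2 then detQuot a T.2 b x else 0) hsel hR]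
    · simp only [ite_mul, zero_mul, Finset.sum_ite_mem, Finset.union_inter_cancel_right]
    · simpa only [ite_smul, zero_smul, Finset.sum_ite_mem, Finset.union_inter_cancel_right]
        using (hP.basis T hT).sum_detQuot x
  have hpolar : ∀ T ∈ P, ∑ b ∈ T.2, detQuot a T.2 b x * polarAt a Q (insert b T.1) =
      polarAt a (fun y => Q (Fin.cons x y)) T.1 := fun T hT =>
    hQ.sum_polarAt_insert (hP.disjoint T hT) ((hP.basis T hT).sum_detQuot x)
  rw [Finset.sum_congr rfl fun T hT => by rw [hspline T hT, mul_left_comm], ← Finset.mul_sum,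
    hP.sum_mul_sum_detQuot hx (fun J => polarAt_of_card_ne)
      fun X => mem_hull_of_spline_ne_zero hχ]
  congr 1
  refine Finset.sum_congr rfl fun T hT => ?_
  rw [hpolar T hT]
  ring

theorem IsFineZonotopalTiling.sum_polarAt_spline (hP : IsFineZonotopalTiling a P)
    (hsel : IsSelection a sel) (hM : IsGenericModel a χ x y) (hy : y ∈ hull a Finset.univ)
    (hk : k ≤ n) (hx : x ∈ chk a k) {Q : (Fin k → Fin d → ℝ) → ℝ} (hQ : IsSymmMultiaffine Q) :
    ∑ T ∈ P, polarAt a Q T.1 * posDet a T.2 * spline a χ sel k (T.1 ∪ T.2) x =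
      ((k + d).factorial : ℝ) / (k.factorial : ℝ) * Q fun _ => x := by
  induction k with
  | zero =>
    have hχ : ∑ T ∈ P with T.1 = ∅, χ T.2 x = 1 := by
      simpa only [hM.apply_eq] using hP.sum_closedInd hy hM.generic
    rw [hP.sum_polarAt_spline_zero hχ, Nat.zero_add, Nat.factorial_zero, Nat.cast_one, div_one]
  | succ k ih =>
    have hR := respectsRelations_spline hsel (hM.respectsRelations_spline_zero sel) k
    have hcons : (Fin.cons x fun _ => x : Fin (k + 1) → Fin d → ℝ) = fun _ => x :=
      funext (Fin.cases rfl fun _ => rfl)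
    rw [hP.sum_polarAt_spline_succ hsel hR (fun B => hM.mem_hull_of_apply_ne_zero) hx hQ,
      ih (Nat.le_of_succ_le hk) (chk_succ_subset hk hx) (hQ.cons x), hcons, ← mul_assoc,
      div_mul_div_comm, Nat.succ_add_eq_add_succ, Nat.add_succ, Nat.factorial_succ,
      Nat.factorial_succ]
    push_cast
    ring

end Reproduction

section Volume

variable {T : Finset (Fin n) × Finset (Fin n)} {m : ℕ}

theorem tile_eq_image_parallelepiped (h : T.2.card = m) :
    tile a T = (fun z => ∑ i ∈ T.1, lift (a i) + z) ''
      parallelepiped fun j => lift (a (T.2.orderEmbOfFin h j)) := by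
  have hsum (α : Fin n → ℝ) : ∑ b ∈ T.2, α b • lift (a b) =
      ∑ j, α (T.2.orderEmbOfFin h j) • lift (a (T.2.orderEmbOfFin h j)) := by
    conv_lhs => rw [← Finset.map_orderEmbOfFin_univ T.2 h, Finset.sum_map]
    rfl
  ext z
  constructor
  · rintro ⟨α, hα, rfl⟩
    exact ⟨_, (mem_parallelepiped_iff _ _).2 ⟨fun j => α (T.2.orderEmbOfFin h j),
      ⟨fun j => (hα _).1, fun j => (hα _).2⟩, hsum α⟩, rfl⟩
  · rintro ⟨_, hz, rfl⟩
    obtain ⟨β, hβ, rfl⟩ := (mem_parallelepiped_iff _ _).1 hz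
    have hinj := (T.2.orderEmbOfFin h).injective
    refine ⟨Function.extend (T.2.orderEmbOfFin h) β 0, fun i => ?_, ?_⟩
    · by_cases hi : ∃ j, T.2.orderEmbOfFin h j = i
      · obtain ⟨j, rfl⟩ := hi
        rw [hinj.extend_apply]
        exact ⟨hβ.1 j, hβ.2 j⟩
      · rw [Function.extend_apply' _ _ _ hi]
        exact Set.left_mem_Icc.2 zero_le_one
    · simp only [hsum, hinj.extend_apply]

theorem volume_tile (h : T.2.card = d + 1) : volume.real (tile a T) = posDet a T.2 := by
  rw [tile_eq_image_parallelepiped h, Measure.real, Set.image_add_left, measure_preimage_add,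
    ← addHaarMeasure_eq_volume_pi, ← Module.Basis.parallelepiped_basisFun,
    ← Module.Basis.addHaar_def, Measure.addHaar_parallelepiped, Pi.basisFun_det_apply,
    ENNReal.toReal_ofReal (abs_nonneg _), posDet, orderedDet, dif_pos h]

end Volume

section Polarization

variable {k : ℕ} {q q₁ q₂ : MvPolynomial (Fin d) ℝ} {Q Q₁ Q₂ : (Fin k → Fin d → ℝ) → ℝ}

theorem exists_affineMap_sum {ι : Type*} {s : Finset ι} {φ : ι → (Fin d → ℝ) → ℝ}
    (h : ∀ i ∈ s, ∃ f : (Fin d → ℝ) →ᵃ[ℝ] ℝ, ∀ z, φ i z = f z) :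
    ∃ f : (Fin d → ℝ) →ᵃ[ℝ] ℝ, ∀ z, ∑ i ∈ s, φ i z = f z := by
  simp only [← Finset.sum_apply]
  refine Finset.sum_induction φ (fun ψ => ∃ f : (Fin d → ℝ) →ᵃ[ℝ] ℝ, ∀ z, ψ z = f z) ?_
    ⟨0, fun z => rfl⟩ h
  rintro _ _ ⟨f, hf⟩ ⟨g, hg⟩
  exact ⟨f + g, fun z => congrArg₂ (· + ·) (hf z) (hg z)⟩

namespace IsPolarForm

theorem zero (k : ℕ) : IsPolarForm k (0 : MvPolynomial (Fin d) ℝ) 0 where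
  symm _ _ := rfl
  affine _ _ := ⟨0, fun _ => rfl⟩
  diag _ := (map_zero _).symm

theorem add (h₁ : IsPolarForm k q₁ Q₁) (h₂ : IsPolarForm k q₂ Q₂) :
    IsPolarForm k (q₁ + q₂) (Q₁ + Q₂) where
  symm π y := congrArg₂ (· + ·) (h₁.symm π y) (h₂.symm π y)
  affine y j := by
    obtain ⟨f₁, hf₁⟩ := h₁.affine y j
    obtain ⟨f₂, hf₂⟩ := h₂.affine y j
    exact ⟨f₁ + f₂, fun z => congrArg₂ (· + ·) (hf₁ z) (hf₂ z)⟩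
  diag x := by rw [Pi.add_apply, h₁.diag, h₂.diag, map_add]

theorem smul (c : ℝ) (h : IsPolarForm k q Q) : IsPolarForm k (c • q) (c • Q) where
  symm π y := congrArg (c • ·) (h.symm π y)
  affine y j := by
    obtain ⟨f, hf⟩ := h.affine y j
    exact ⟨c • f, fun z => congrArg (c • ·) (hf z)⟩
  diag x := by rw [Pi.smul_apply, h.diag, MvPolynomial.smul_eval, smul_eq_mul]

theorem symmetrization {g : Fin k → (Fin d → ℝ) →ᵃ[ℝ] ℝ}
    (hq : ∀ x, ∏ j, g j x = MvPolynomial.eval x q) :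
    IsPolarForm k q fun y =>
      (k.factorial : ℝ)⁻¹ * ∑ π : Equiv.Perm (Fin k), ∏ j, g j (y (π j)) where
  symm π y := congrArg _ (Fintype.sum_equiv (Equiv.mulLeft π) _ _ fun σ => rfl)
  affine y i := by
    obtain ⟨f, hf⟩ : ∃ f : (Fin d → ℝ) →ᵃ[ℝ] ℝ, ∀ z,
        ∑ π : Equiv.Perm (Fin k), ∏ j, g j (Function.update y i z (π j)) = f z := by
      refine exists_affineMap_sum fun π _ =>
        ⟨(∏ j ∈ Finset.univ.erase (π.symm i), g j (y (π j))) • g (π.symm i), fun z => ?_⟩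
      rw [← Finset.prod_erase_mul _ _ (Finset.mem_univ (π.symm i)), Equiv.apply_symm_apply,
        Function.update_self]
      refine congrArg (· * _) (Finset.prod_congr rfl fun j hj => ?_)
      rw [Function.update_of_ne]
      rintro rfl
      exact Finset.ne_of_mem_erase hj (π.symm_apply_apply j).symm
    exact ⟨(k.factorial : ℝ)⁻¹ • f, fun z => congrArg _ (hf z)⟩
  diag x := by
    simp only [hq, Finset.sum_const, Finset.card_univ, Fintype.card_perm, Fintype.card_fin,
      nsmul_eq_mul]
    exact inv_mul_cancel_left₀ (Nat.cast_ne_zero.2 k.factorial_ne_zero) _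

end IsPolarForm

theorem exists_affineMap_prod_eq (l : List (Fin d)) (hl : l.length ≤ k) :
    ∃ g : Fin k → (Fin d → ℝ) →ᵃ[ℝ] ℝ, ∀ x : Fin d → ℝ, ∏ j, g j x = (l.map x).prod := by
  induction k generalizing l with
  | zero =>
    obtain rfl := List.length_eq_zero_iff.1 (Nat.le_zero.1 hl)
    exact ⟨Fin.elim0, fun x => rfl⟩
  | succ k ih =>
    cases l with
    | nil => exact ⟨fun _ => AffineMap.const ℝ _ 1, fun _ => Finset.prod_const_one⟩
    | cons i l =>
      obtain ⟨g, hg⟩ := ih l (Nat.le_of_succ_le_succ hl)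
      refine ⟨Fin.cons (LinearMap.proj i : (Fin d → ℝ) →ₗ[ℝ] ℝ).toAffineMap g, fun x => ?_⟩
      rw [Fin.prod_univ_succ, List.map_cons, List.prod_cons, ← hg]
      rfl

theorem exists_isPolarForm_monomial {m : Fin d →₀ ℕ} (hm : (m.sum fun _ e => e) ≤ k) :
    ∃ Q, IsPolarForm k (MvPolynomial.monomial m (1 : ℝ)) Q := by
  obtain ⟨g, hg⟩ := exists_affineMap_prod_eq (k := k) (Finsupp.toMultiset m).toList
    (by rwa [Multiset.length_toList, Finsupp.card_toMultiset])
  refine ⟨_, IsPolarForm.symmetrization (g := g) fun x => ?_⟩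
  rw [hg, MvPolynomial.eval_monomial, one_mul, ← Multiset.prod_coe, ← Multiset.map_coe,
    Multiset.coe_toList, Finsupp.toMultiset_map, Finsupp.prod_toMultiset,
    Finsupp.prod_mapDomain_index (fun _ => pow_zero _) fun _ _ _ => pow_add _ _ _]

theorem exists_isPolarForm (hq : q.totalDegree ≤ k) : ∃ Q, IsPolarForm k q Q := by
  rw [q.as_sum]
  refine Finset.sum_induction _ (fun p => ∃ Q, IsPolarForm k p Q) ?_ ⟨0, .zero k⟩ fun m hm => ?_
  · rintro _ _ ⟨Q₁, h₁⟩ ⟨Q₂, h₂⟩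
    exact ⟨_, h₁.add h₂⟩
  · obtain ⟨Q, hQ⟩ := exists_isPolarForm_monomial ((MvPolynomial.le_totalDegree hm).trans hq)
    have hcoeff := hQ.smul (q.coeff m)
    rw [MvPolynomial.smul_monomial, smul_eq_mul, mul_one] at hcoeff
    exact ⟨_, hcoeff⟩

end Polarization

theorem IsFineZonotopalTiling.eval_eq_splineSum
    {P : Finset (Finset (Fin n) × Finset (Fin n))} (hP : IsFineZonotopalTiling a P)
    {χ : Finset (Fin n) → (Fin d → ℝ) → ℝ} {sel : Finset (Fin n) → Finset (Fin n)}
    (hsel : IsSelection a sel) {x y : Fin d → ℝ} (hM : IsGenericModel a χ x y)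
    (hy : y ∈ hull a Finset.univ) {k : ℕ} (hk : k ≤ n) (hx : x ∈ chk a k)
    {q : MvPolynomial (Fin d) ℝ} {Q : (Fin k → Fin d → ℝ) → ℝ} (hQ : IsPolarForm k q Q) :
    MvPolynomial.eval x q = splineSum a χ sel P k Q x := by
  have hsum : ∑ T ∈ P with T.1.card = k,
      polarAt a Q T.1 * volume.real (tile a T) * spline a χ sel k (T.1 ∪ T.2) x =
      ∑ T ∈ P, polarAt a Q T.1 * posDet a T.2 * spline a χ sel k (T.1 ∪ T.2) x := by
    rw [Finset.sum_filter_of_ne fun T _ h =>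
      not_imp_comm.1 polarAt_of_card_ne (left_ne_zero_of_mul (left_ne_zero_of_mul h))]
    exact Finset.sum_congr rfl fun T hT => by rw [volume_tile (hP.basis T hT).1]
  rw [splineSum, hsum, hP.sum_polarAt_spline hsel hM hy hk hx hQ.isSymmMultiaffine, hQ.diag,
    ← mul_assoc, div_mul_div_cancel₀ (Nat.cast_ne_zero.2 (k + d).factorial_ne_zero),
    div_self (Nat.cast_ne_zero.2 k.factorial_ne_zero), one_mul]

end ZonotopalSpline

end

theorem theorem3 {d n : ℕ} (a : Fin n → Fin d → ℝ)
    (ha : affineSpan ℝ (Set.range a) = ⊤)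
    (P : Finset (Finset (Fin n) × Finset (Fin n)))
    (hP : ZonotopalSpline.IsFineZonotopalTiling a P)
    (k : ℕ) (hk : k + d + 1 ≤ n)
    (sel : Finset (Fin n) → Finset (Fin n)) (hsel : ZonotopalSpline.IsSelection a sel)
    (q : MvPolynomial (Fin d) ℝ) (hq : q.totalDegree ≤ k) :
    (∃ Q : (Fin k → Fin d → ℝ) → ℝ, ZonotopalSpline.IsPolarForm k q Q) ∧
    ∀ Q : (Fin k → Fin d → ℝ) → ℝ, ZonotopalSpline.IsPolarForm k q Q →
      (∀ x ∈ ZonotopalSpline.chk a k,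
        (∀ S : Finset (Fin n), S.card = d → x ∉ ZonotopalSpline.hull a S) →
        MvPolynomial.eval x q =
          ZonotopalSpline.splineSum a (ZonotopalSpline.closedInd a) sel P k Q x) ∧
      (∀ p ∈ convexHull ℝ (Set.range a),
        (∀ S : Finset (Fin n), S.card = d → p ∉ affineSpan ℝ (a '' (S : Set (Fin n)))) →
        ∀ x ∈ ZonotopalSpline.chk a k,
          MvPolynomial.eval x q =
            ZonotopalSpline.splineSum a (ZonotopalSpline.halfOpenInd a p) sel P k Q x) := by
  open ZonotopalSpline in
  refine ⟨exists_isPolarForm hq, fun Q hQ => ?_⟩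
  have hkn : k ≤ n := by lia
  refine ⟨fun x hx hgen => ?_, fun p hpA hp x hx => ?_⟩
  · exact hP.eval_eq_splineSum hsel (isGenericModel_closedInd hgen) (chk_subset_hull_univ hkn hx)
      hkn hx hQ
  · obtain ⟨y, hy, hM⟩ := exists_isGenericModel_halfOpenInd (chk_subset_hull_univ hkn hx)
      (by simpa [hull] using hpA) hp
    exact hP.eval_eq_splineSum hsel hM hy hkn hx hQ
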